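/- Let $c,\rho,b,\lambda_N,\delta>0$, and let $f_Y$ be a probability density on $[0,\infty)$ of class $C^2_0$ (that is, $f_Y\in C^2([0,\infty))$ and $f_Y,f_Y',f_Y''$ vanish at infinity). Consider the Cramér–Lundberg model with loan and dividend barrier, as a piecewise deterministic Markov process $X$ with the components $E_1=(-\frac c\rho,b)$, $E_2=(-\infty,-\frac c\rho)$, $E_3=\{-\frac c\rho\}$, $E_4=\{b\}$ and state space $E=\bigcup_{k}\{k\}\times E_k$. On $E_1$ the process follows the flow $\phi$ of $z'=g(z)$, where $g(y)=c$ for $y>0$, $g(y)=c+\rho y$ for $-\frac c\rho<y\le 0$ and $g(y)=0$ for $y\le-\frac c\rho$; on $E_2,E_3,E_4$ it is constant between jumps. The jump intensity is $\lambda_N$ on $E_1$ and $E_4$, and $0$ on $E_2$ and $E_3$. At a claim the process jumps from $(k,y)$ to the state with second coordinate $y-Y$, where $Y$ has density $f_Y$; when it reaches the point $b$ of the active boundary of $E_1$ it moves to $(4,b)$. Let $E^c=(\{2\}\times E_2)\cup(\{3\}\times E_3)$ and $$V(x)=\mathbb E_x\Big(\int_0^\tau e^{-\delta s}\ell(X_s)\,ds\Big),\qquad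 \tau=\inf\{t\ge0: X_t\in E^c\},$$ where $\ell=c$ on $\{4\}\times E_4$ and $\ell=0$ elsewhere. Let $h\colon\mathbb R\to[0,1]$ be a $C^2$-Heaviside function ($h=0$ on $(-\infty,-1)$, $h=1$ on $(1,\infty)$, $h$ is non-decreasing, $h(y)+h(-y)=1$, and $h\in C^2$) whose second derivative is Lipschitz continuous; for instance $h(y)=\frac12+\frac{15y}{16}-\frac{5y^3}{8}+\frac{3y^5}{16}$ on $[-1,1]$. For $0<\varepsilon\le\min(\frac b2,\frac c\rho)$ let $$g^\varepsilon(y)=\begin{cases}c,& y\in(\varepsilon,b-\varepsilon],\\ c(b-y)^3\big(15\varepsilon(y-b)+6(b-y)^2+10\varepsilon^2\big)/\varepsilon^5,& y\in(b-\varepsilon,b),\\ c+\rho y,& y\in(-\frac c\rho,-\varepsilon),\\ c+\rho(y+3\varepsilon)(y-\varepsilon)^3/(16\varepsilon^3),& y\in[-\varepsilon,\varepsilon],\\ 0,& y\in(-\infty,-\frac c\rho]\cup[b,\infty).\end{cases}$$ Let $X^\varepsilon$ be the piecewise deterministic Markov process specified like $X$, except that on $E_1$ it follows the flow of $z'=g^\varepsilon(z)$,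 and let $$V^\varepsilon(x)=\mathbb E_x\Big(\int_0^{\tau^\varepsilon} e^{-\delta s}\ell^\varepsilon(X^\varepsilon_s)\,ds\Big),\qquad \tau^\varepsilon=\inf\{t\ge0: X^\varepsilon_t\in E^c\},$$ where $\ell^\varepsilon(1,y)=c\,h\big(\frac{y-b+\varepsilon}{\varepsilon}\big)$, $\ell^\varepsilon(4,b)=c$ and $\ell^\varepsilon=0$ on $E^c$. Then there exists a constant $C>0$, independent of $\varepsilon$, such that $\|V^\varepsilon-V\|_\infty=\sup_{x\in E}|V^\varepsilon(x)-V(x)|\le C\varepsilon$ for all $0<\varepsilon\le\min(\frac b2,\frac c\rho)$. -/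

import Mathlib

open MeasureTheory ProbabilityTheory Filter Topology Set
open scoped ENNReal NNReal

/-! ### Piecewise deterministic Markov processes with one-dimensional components -/

/-- The data of a piecewise deterministic Markov process with state space
`⋃ k, {k} × dom k`, where `dom k ⊆ ℝ`:
flows `flow k y t`, jump intensities `rate k y`, and jump laws `jump (k, y)`. -/
structure PDMPData (K : Type) [MeasurableSpace K] where
  dom : K → Set ℝ
  flow : K → ℝ → ℝ → ℝ
  rate : K → ℝ → ℝ
  jump : K × ℝ → Measure (K × ℝ)

namespace PDMPData

variable {K : Type} [MeasurableSpace K] (D : PDMPData K)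

/-- The state space `E = ⋃ k, {k} × E_k`. -/
def stateSpace : Set (K × ℝ) := {x | x.2 ∈ D.dom x.1}

/-- The active boundary of the component `k`: boundary points that are reached by the flow
from the interior. -/
def activeBoundary (k : K) : Set ℝ :=
  {y | y ∈ frontier (D.dom k) ∧
    ∃ η : ℝ, 0 < η ∧ ∀ t ∈ Ioo (0 : ℝ) η, D.flow k y (-t) ∈ interior (D.dom k)}

/-- The first time at which the trajectory from `x` hits the active boundary (`∞` if never). -/
noncomputable def tStar (x : K × ℝ) : ℝ≥0∞ :=
  ⨅ (t : ℝ) (_ : 0 < t ∧ D.flow x.1 x.2 t ∈ D.activeBoundary x.1), ENNReal.ofReal t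

/-- The state reached from `x` by following the flow for the time `t`. -/
def move (x : K × ℝ) (t : ℝ) : K × ℝ := (x.1, D.flow x.1 x.2 t)

/-- The probability that the first jump from `x` occurs after time `t ≥ 0`. -/
noncomputable def survival (x : K × ℝ) (t : ℝ) : ℝ :=
  open Classical in
  if ENNReal.ofReal t < D.tStar x then
    Real.exp (-∫ s in (0 : ℝ)..t, D.rate x.1 (D.flow x.1 x.2 s))
  else 0

/-- The σ-algebra generated by the first `n` jump times and post-jump locations (and by the
initial ones). -/
abbrev history {Ω : Type*} (T : ℕ → Ω → ℝ≥0∞) (Z : ℕ → Ω → K × ℝ) (n : ℕ) : MeasurableSpace Ω :=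
  ⨆ i ∈ Iic n, (MeasurableSpace.comap (T i) inferInstance ⊔
    MeasurableSpace.comap (Z i) inferInstance)

/-- `X` (a process indexed by `t ≥ 0`) is a piecewise deterministic Markov process with data `D`
started in `x`, with jump times `T 1 ≤ T 2 ≤ …` (and `T 0 = 0`) and post-jump locations `Z n`
(which carry meaning only where `T n < ∞`). -/
structure IsPDMPWith {Ω : Type*} [MeasurableSpace Ω] (P : Measure Ω) (x : K × ℝ)
    (X : ℝ → Ω → K × ℝ) (T : ℕ → Ω → ℝ≥0∞) (Z : ℕ → Ω → K × ℝ) : Prop where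
  measurable_X : ∀ t, 0 ≤ t → Measurable (X t)
  mem_stateSpace : ∀ t, 0 ≤ t → ∀ ω, X t ω ∈ D.stateSpace
  measurable_T : ∀ n, Measurable (T n)
  measurable_Z : ∀ n, Measurable (Z n)
  T_zero : ∀ᵐ ω ∂P, T 0 ω = 0
  Z_zero : ∀ᵐ ω ∂P, Z 0 ω = x
  T_mono : ∀ᵐ ω ∂P, ∀ n, T n ω ≤ T (n + 1) ω
  T_tendsto : ∀ᵐ ω ∂P, Tendsto (fun n => T n ω) atTop (𝓝 ⊤)
  /-- Between two jumps the process follows the flow. -/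
  path : ∀ᵐ ω ∂P, ∀ (n : ℕ) (t : ℝ), 0 ≤ t → T n ω ≤ ENNReal.ofReal t →
    ENNReal.ofReal t < T (n + 1) ω → X t ω = D.move (Z n ω) (t - (T n ω).toReal)
  /-- The conditional law of the waiting time for the next jump. -/
  wait : ∀ (n : ℕ) (t : ℝ), 0 ≤ t → ∀ᵐ ω ∂P, T n ω ≠ ⊤ →
    (P⟦{ω' | T n ω' + ENNReal.ofReal t < T (n + 1) ω'} | history T Z n⟧) ω
      = D.survival (Z n ω) t
  /-- The conditional law of the post-jump location, given the past up to and including the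
  jump time; it is the jump law at the pre-jump location. -/
  jump_law : ∀ (n : ℕ) (A : Set (K × ℝ)), MeasurableSet A → ∀ᵐ ω ∂P, T (n + 1) ω ≠ ⊤ →
    (P⟦Z (n + 1) ⁻¹' A |
        history T Z n ⊔ MeasurableSpace.comap (T (n + 1)) inferInstance⟧) ω
      = (D.jump (D.move (Z n ω) (T (n + 1) ω - T n ω).toReal)).real A

/-- `X` is a piecewise deterministic Markov process with data `D` started in `x`. -/
def IsPDMP {Ω : Type*} [MeasurableSpace Ω] (P : Measure Ω) (x : K × ℝ)
    (X : ℝ → Ω → K × ℝ) : Prop :=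
  ∃ (T : ℕ → Ω → ℝ≥0∞) (Z : ℕ → Ω → K × ℝ), D.IsPDMPWith P x X T Z

end PDMPData

/-- The first time `t ≥ 0` at which the path `X · ω` is in the set `A`. -/
noncomputable def entryTime {Ω S : Type*} (X : ℝ → Ω → S) (A : Set S) (ω : Ω) : ℝ≥0∞ :=
  ⨅ (t : ℝ) (_ : 0 ≤ t ∧ X t ω ∈ A), ENNReal.ofReal t

/-- The expected discounted running reward
`𝔼 (∫₀^τ exp (-δ t) ℓ (X t) dt)`, where `τ` is the entry time of `X` into `A`. -/
noncomputable def expectedReward {Ω S : Type*} [MeasurableSpace Ω] (P : Measure Ω)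
    (X : ℝ → Ω → S) (δ : ℝ) (ell : S → ℝ) (A : Set S) : ℝ :=
  ∫ ω, (∫ t in {t : ℝ | 0 ≤ t ∧ ENNReal.ofReal t < entryTime X A ω},
    Real.exp (-δ * t) * ell (X t ω)) ∂P

/-- `φ y t` is the flow of the autonomous equation `z' = g z` on the real line. -/
def IsODEFlow (g : ℝ → ℝ) (φ : ℝ → ℝ → ℝ) : Prop :=
  ∀ y, φ y 0 = y ∧ ∀ t, HasDerivAt (φ y) (g (φ y t)) t

/-! ### The Cramér–Lundberg model with loan and dividend barrier -/

/-- The components of the state space: `active` for the surplus in `(-c/ρ, b)`, `ruined` for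
`(-∞, -c/ρ)`, `critical` for `{-c/ρ}` and `barrier` for `{b}`. -/
inductive Phase : Type
  | active
  | ruined
  | critical
  | barrier
  deriving DecidableEq

instance : Fintype Phase where
  elems := {.active, .ruined, .critical, .barrier}
  complete := fun k => by cases k <;> decide

instance : MeasurableSpace Phase := ⊤

instance : DiscreteMeasurableSpace Phase := ⟨fun _ => trivial⟩

/-- The sets `E_k`. -/
def phaseDom (c ρ b : ℝ) : Phase → Set ℝ
  | .active => Ioo (-(c / ρ)) b
  | .ruined => Iio (-(c / ρ))
  | .critical => {-(c / ρ)}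
  | .barrier => {b}

/-- `f` is a probability density on `[0, ∞)` in the class `C₀²`. -/
structure IsClaimDensity (f : ℝ → ℝ) : Prop where
  nonneg : ∀ y, 0 ≤ y → 0 ≤ f y
  integral_eq_one : ∫ y in Ici (0 : ℝ), f y = 1
  contDiffOn : ContDiffOn ℝ 2 f (Ici 0)
  vanish : ∀ k : ℕ, k ≤ 2 → Tendsto (iteratedDerivWithin k f (Ici 0)) atTop (𝓝 0)

/-- The law of a claim `Y` with density `f` on `[0, ∞)`. -/
noncomputable def claimLaw (f : ℝ → ℝ) : Measure ℝ :=
  (volume.restrict (Ici 0)).withDensity fun y => ENNReal.ofReal (f y)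

/-- The jump law. From `(active, b)`, a point of the active boundary, the process moves to
`(barrier, b)`. From any other `(k, y)` a claim `Y` is subtracted from `y`:
`B = ⋃ j, {j} × B j` has the mass `∑ j, ℙ (y - Y ∈ B j)`. -/
noncomputable def claimJump (c ρ b : ℝ) (f : ℝ → ℝ) (x : Phase × ℝ) : Measure (Phase × ℝ) :=
  open Classical in
  if x = (Phase.active, b) then Measure.dirac (Phase.barrier, b)
  else ∑ j : Phase, (((claimLaw f).map fun z => x.2 - z).restrict (phaseDom c ρ b j)).map (Prod.mk j)

/-- The model with claim intensity `lam` and claim density `f` in which the surplus in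
`(-c/ρ, b)` follows the flow `φ`; at the barrier and after ruin it is constant between jumps,
and there are no jumps after ruin. -/
noncomputable def loanModel (c ρ b lam : ℝ) (f : ℝ → ℝ) (φ : ℝ → ℝ → ℝ) : PDMPData Phase where
  dom := phaseDom c ρ b
  flow
    | .active => φ
    | _ => fun y _ => y
  rate
    | .active => fun _ => lam
    | .barrier => fun _ => lam
    | _ => fun _ => 0
  jump := claimJump c ρ b f

/-- The states after ruin (surplus at most `-c/ρ`). -/
def cemetery (c ρ b : ℝ) : Set (Phase × ℝ) :=
  {x | x.2 ∈ phaseDom c ρ b x.1 ∧ (x.1 = Phase.ruined ∨ x.1 = Phase.critical)}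

/-- The drift `g` of the surplus below the barrier. -/
noncomputable def drift (c ρ : ℝ) (y : ℝ) : ℝ :=
  if 0 < y then c else if -(c / ρ) < y then c + ρ * y else 0

/-- The smoothed drift `g^ε`; for `ε ≤ b / 2` and `ε ≤ c / ρ` the cases are consistent. -/
noncomputable def smoothDrift (c ρ b ε : ℝ) (y : ℝ) : ℝ :=
  if ε < y ∧ y ≤ b - ε then c
  else if b - ε < y ∧ y < b then
    c * (b - y) ^ 3 * (15 * ε * (y - b) + 6 * (b - y) ^ 2 + 10 * ε ^ 2) / ε ^ 5
  else if -(c / ρ) < y ∧ y < -ε then c + ρ * y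
  else if -ε ≤ y ∧ y ≤ ε then c + ρ * (y + 3 * ε) * (y - ε) ^ 3 / (16 * ε ^ 3)
  else 0

/-- A `C^κ`-Heaviside function. -/
structure IsHeaviside (κ : ℕ) (h : ℝ → ℝ) : Prop where
  mem_Icc : ∀ y, h y ∈ Icc (0 : ℝ) 1
  eq_zero : ∀ y, y < -1 → h y = 0
  eq_one : ∀ y, 1 < y → h y = 1
  monotone : Monotone h
  symm : ∀ y, h y + h (-y) = 1
  contDiff : ContDiff ℝ κ h

/-- The dividend rate `ℓ`: the premium rate `c` is paid out at the barrier. -/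
def dividend (c : ℝ) (x : Phase × ℝ) : ℝ :=
  match x.1 with
  | .barrier => c
  | _ => 0

/-- The smoothed dividend rate `ℓ^ε`. -/
noncomputable def smoothDividend (c b ε : ℝ) (h : ℝ → ℝ) (x : Phase × ℝ) : ℝ :=
  match x.1 with
  | .active => c * h ((x.2 - b + ε) / ε)
  | .barrier => c
  | _ => 0

/-- Integrating an `m`-measurable weight over an event whose conditional probability given `m` is
known wherever the weight does not vanish. -/
theorem setLIntegral_of_condExp {Ω : Type*} {m mΩ : MeasurableSpace Ω} (hm : m ≤ mΩ)
    (P : Measure Ω) [IsProbabilityMeasure P] {A : Set Ω} (hA : MeasurableSet A)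
    {G : Ω → ℝ≥0∞} (hG : Measurable[m] G) {κ : Ω → ℝ}
    (hκ : ∀ᵐ ω ∂P, G ω ≠ 0 → (P⟦A | m⟧) ω = κ ω) :
    ∫⁻ ω in A, G ω ∂P = ∫⁻ ω, G ω * ENNReal.ofReal (κ ω) ∂P := by
  have hce : Measurable[m] fun ω => ENNReal.ofReal ((P⟦A | m⟧) ω) :=
    ENNReal.measurable_ofReal.comp stronglyMeasurable_condExp.measurable
  have hnn : 0 ≤ᵐ[P] P⟦A | m⟧ := condExp_nonneg
    (ae_of_all _ fun ω => indicator_nonneg (fun _ _ => zero_le_one) ω)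
  have key : (P.restrict A).trim hm =
      (P.withDensity fun ω => ENNReal.ofReal ((P⟦A | m⟧) ω)).trim hm := by
    refine @Measure.ext _ m _ _ fun B hB => ?_
    rw [trim_measurableSet_eq hm hB, trim_measurableSet_eq hm hB, Measure.restrict_apply (hm _ hB),
      withDensity_apply _ (hm _ hB), ← ofReal_integral_eq_lintegral_ofReal
        integrable_condExp.integrableOn (ae_restrict_of_ae hnn),
      setIntegral_condExp hm ((integrable_const 1).indicator hA) hB, integral_indicator hA,
      Measure.restrict_restrict hA]
    simp [inter_comm, Measure.real]
  rw [← lintegral_trim hm hG, key, lintegral_trim hm hG,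
    lintegral_withDensity_eq_lintegral_mul _ (hce.mono hm le_rfl) (hG.mono hm le_rfl)]
  refine lintegral_congr_ae ?_
  filter_upwards [hκ] with ω hω
  by_cases h : G ω = 0
  · simp [h]
  · simp [hω h, mul_comm]

/-- The discount factor `exp (-δ a)` at the time `a ∈ [0, ∞]`. -/
noncomputable def discount (δ : ℝ) (a : ℝ≥0∞) : ℝ≥0∞ :=
  if a = ⊤ then 0 else ENNReal.ofReal (Real.exp (-δ * a.toReal))

theorem measurable_discount (δ : ℝ) : Measurable (discount δ) := by
  unfold discount
  refine Measurable.ite (measurableSet_singleton _) measurable_const ?_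
  fun_prop

theorem discount_top (δ : ℝ) : discount δ ⊤ = 0 := by simp [discount]

theorem discount_zero (δ : ℝ) : discount δ 0 = 1 := by simp [discount]

theorem discount_ofReal (δ : ℝ) {t : ℝ} (ht : 0 ≤ t) :
    discount δ (ENNReal.ofReal t) = ENNReal.ofReal (Real.exp (-δ * t)) := by
  simp [discount, ht]

theorem discount_add (δ : ℝ) (a b : ℝ≥0∞) :
    discount δ (a + b) = discount δ a * discount δ b := by
  by_cases ha : a = ⊤
  · simp [ha, discount]
  by_cases hb : b = ⊤
  · simp [hb, discount]
  simp only [discount, ENNReal.add_eq_top, ha, hb, or_self, if_false]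
  rw [← ENNReal.ofReal_mul (Real.exp_nonneg _), ← Real.exp_add, ENNReal.toReal_add ha hb]
  ring_nf

theorem discount_le_one {δ : ℝ} (hδ : 0 < δ) (a : ℝ≥0∞) : discount δ a ≤ 1 := by
  unfold discount
  split_ifs
  · exact zero_le_one
  · rw [← ENNReal.ofReal_one]
    refine ENNReal.ofReal_le_ofReal (Real.exp_le_one_iff.2 ?_)
    nlinarith [a.toReal_nonneg]

theorem discount_eq_zero_iff {δ : ℝ} {a : ℝ≥0∞} : discount δ a = 0 ↔ a = ⊤ := by
  unfold discount
  split_ifs with h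
  · simp [h]
  · simp [h, Real.exp_pos]

theorem tendsto_discount_top {δ : ℝ} (hδ : 0 < δ) : Tendsto (discount δ) (𝓝 ⊤) (𝓝 0) := by
  rw [ENNReal.tendsto_nhds_zero]
  intro e he
  have h1 : Tendsto (fun t : ℝ => ENNReal.ofReal (Real.exp (-δ * t))) atTop (𝓝 0) := by
    rw [← ENNReal.ofReal_zero]
    refine (ENNReal.continuous_ofReal.tendsto 0).comp (Real.tendsto_exp_atBot.comp ?_)
    exact tendsto_id.const_mul_atTop_of_neg (by linarith)
  obtain ⟨t, ht0, ht⟩ := (((ENNReal.tendsto_nhds_zero.1 h1) e he).and (eventually_ge_atTop 0)).exists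
  have : ∀ᶠ a : ℝ≥0∞ in 𝓝 ⊤, ENNReal.ofReal t < a := lt_mem_nhds ENNReal.ofReal_lt_top
  filter_upwards [this] with a ha
  by_cases h : a = ⊤
  · simp [h, discount]
  · simp only [discount, h, if_false]
    refine le_trans (ENNReal.ofReal_le_ofReal (Real.exp_le_exp.2 ?_)) ht0
    have := (ENNReal.ofReal_lt_iff_lt_toReal ht h).1 ha
    nlinarith

/-- Finite measures on `[0, ∞]` with the same mass and the same tails agree. -/
theorem ENNReal.measure_ext_of_Ioi_ofReal {μ ν : Measure ℝ≥0∞} [IsFiniteMeasure μ]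
    (huniv : μ univ = ν univ)
    (h : ∀ t : ℝ, 0 ≤ t → μ (Ioi (ENNReal.ofReal t)) = ν (Ioi (ENNReal.ofReal t))) : μ = ν := by
  have : IsFiniteMeasure ν := ⟨huniv ▸ measure_lt_top μ univ⟩
  refine Measure.ext_of_Iic _ _ fun a => ?_
  rw [← compl_Ioi, measure_compl measurableSet_Ioi (measure_ne_top _ _),
    measure_compl measurableSet_Ioi (measure_ne_top _ _), huniv]
  by_cases ha : a = ⊤
  · simp [ha]
  · rw [← ENNReal.ofReal_toReal ha, h _ ENNReal.toReal_nonneg]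

namespace PDMPData

variable {K : Type} [MeasurableSpace K] {D : PDMPData K}

/-- Measurability of the data, together with a measurable map `w` which turns a random number
with law `θ` into a waiting time for the next jump. -/
structure IsSampledBy (D : PDMPData K) (θ : Measure ℝ) (w : K × ℝ → ℝ → ℝ≥0∞) : Prop where
  measurable_move : Measurable fun p : (K × ℝ) × ℝ => D.move p.1 p.2
  measurable_jump : Measurable D.jump
  isFiniteMeasure_jump : ∀ z, IsFiniteMeasure (D.jump z)
  measurableSet_stateSpace : MeasurableSet D.stateSpace
  jump_compl : ∀ z, D.jump z D.stateSpaceᶜ = 0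
  measurable_w : Measurable (Function.uncurry w)
  wait_law : ∀ z ∈ D.stateSpace, ∀ t : ℝ, 0 ≤ t →
    θ {s | ENNReal.ofReal t < w z s} = ENNReal.ofReal (D.survival z t)

variable {Ω : Type*} {T : ℕ → Ω → ℝ≥0∞} {Z : ℕ → Ω → K × ℝ} {θ : Measure ℝ}
  {w : K × ℝ → ℝ → ℝ≥0∞} {δ : ℝ}

theorem measurable_history_T {i n : ℕ} (h : i ≤ n) : Measurable[history T Z n] (T i) := by
  have : MeasurableSpace.comap (T i) inferInstance ≤ history T Z n :=
    le_trans le_sup_left (le_iSup₂_of_le i (mem_Iic.2 h) le_rfl)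
  exact (comap_measurable (T i)).mono this le_rfl

theorem measurable_history_Z {i n : ℕ} (h : i ≤ n) : Measurable[history T Z n] (Z i) := by
  have : MeasurableSpace.comap (Z i) inferInstance ≤ history T Z n :=
    le_trans le_sup_right (le_iSup₂_of_le i (mem_Iic.2 h) le_rfl)
  exact (comap_measurable (Z i)).mono this le_rfl

variable [MeasurableSpace Ω] {P : Measure Ω} {x : K × ℝ} {X : ℝ → Ω → K × ℝ}

theorem IsPDMPWith.history_le (hX : D.IsPDMPWith P x X T Z) (n : ℕ) :
    history T Z n ≤ ‹MeasurableSpace Ω› :=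
  iSup₂_le fun i _ => sup_le (hX.measurable_T i).comap_le (hX.measurable_Z i).comap_le

theorem IsPDMPWith.lintegral_jump [IsProbabilityMeasure P] (hX : D.IsPDMPWith P x X T Z)
    (hD : D.IsSampledBy θ w) (n : ℕ) {G : ℝ≥0∞ → ℝ≥0∞} (hG : Measurable G) (hG0 : G ⊤ = 0)
    {v : K × ℝ → ℝ≥0∞} (hv : Measurable v) :
    ∫⁻ ω, G (T (n + 1) ω) * v (Z (n + 1) ω) ∂P = ∫⁻ ω, G (T (n + 1) ω) *
      ∫⁻ y, v y ∂(D.jump (D.move (Z n ω) (T (n + 1) ω - T n ω).toReal)) ∂P := by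
  have hT := hX.measurable_T
  have hZ := hX.measurable_Z
  have hGT : Measurable fun ω => G (T (n + 1) ω) := hG.comp (hT _)
  have hκ : Measurable fun ω => D.jump (D.move (Z n ω) (T (n + 1) ω - T n ω).toReal) :=
    hD.measurable_jump.comp (hD.measurable_move.comp
      ((hZ n).prodMk ((hT (n + 1)).sub (hT n)).ennreal_toReal))
  have key : (P.withDensity fun ω => G (T (n + 1) ω)).map (Z (n + 1)) =
      (P.withDensity fun ω => G (T (n + 1) ω)).bind
        fun ω => D.jump (D.move (Z n ω) (T (n + 1) ω - T n ω).toReal) := by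
    ext A hA
    have hm : history T Z n ⊔ MeasurableSpace.comap (T (n + 1)) inferInstance
        ≤ ‹MeasurableSpace Ω› := sup_le (hX.history_le n) (hT (n + 1)).comap_le
    have hGm : Measurable[history T Z n ⊔ MeasurableSpace.comap (T (n + 1)) inferInstance]
        fun ω => G (T (n + 1) ω) :=
      hG.comp ((comap_measurable (T (n + 1))).mono le_sup_right le_rfl)
    have hκA : Measurable fun ω => D.jump (D.move (Z n ω) (T (n + 1) ω - T n ω).toReal) A :=
      (Measure.measurable_coe hA).comp hκ
    rw [Measure.map_apply (hZ _) hA, Measure.bind_apply hA hκ.aemeasurable,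
      withDensity_apply _ (hZ _ hA),
      setLIntegral_of_condExp (κ := fun ω =>
        (D.jump (D.move (Z n ω) (T (n + 1) ω - T n ω).toReal)).real A) hm P (hZ _ hA) hGm,
      lintegral_withDensity_eq_lintegral_mul _ hGT hκA]
    · have := hD.isFiniteMeasure_jump
      simp
    · filter_upwards [hX.jump_law n A hA] with ω hω h0
      exact hω fun h => h0 (by rw [h, hG0])
  have h1 : ∫⁻ y, v y ∂((P.withDensity fun ω => G (T (n + 1) ω)).map (Z (n + 1))) =
    ∫⁻ ω, G (T (n + 1) ω) * v (Z (n + 1) ω) ∂P := by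
    have hvZ : Measurable fun ω => v (Z (n + 1) ω) := hv.comp (hZ _)
    rw [lintegral_map hv (hZ _), lintegral_withDensity_eq_lintegral_mul _ hGT hvZ]
    rfl
  have hvκ : Measurable fun ω =>
      ∫⁻ y, v y ∂(D.jump (D.move (Z n ω) (T (n + 1) ω - T n ω).toReal)) :=
    (Measure.measurable_lintegral hv).comp hκ
  rw [← h1, key, Measure.lintegral_bind hκ.aemeasurable hv.aemeasurable,
    lintegral_withDensity_eq_lintegral_mul _ hGT hvκ]
  rfl

theorem IsPDMPWith.ae_mem_stateSpace [IsProbabilityMeasure P] (hX : D.IsPDMPWith P x X T Z)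
    (hD : D.IsSampledBy θ w) (hx : x ∈ D.stateSpace) (n : ℕ) :
    ∀ᵐ ω ∂P, T n ω ≠ ⊤ → Z n ω ∈ D.stateSpace := by
  cases n with
  | zero =>
    filter_upwards [hX.Z_zero] with ω hω _
    rwa [hω]
  | succ n =>
    have hS := hD.measurableSet_stateSpace.compl
    have h := hX.lintegral_jump hD n (measurable_discount 1) (discount_top 1)
      (measurable_const.indicator (f := fun _ => (1 : ℝ≥0∞)) hS)
    have h0 : ∀ z, ∫⁻ y, (D.stateSpaceᶜ).indicator (fun _ => (1 : ℝ≥0∞)) y ∂(D.jump z) = 0 := by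
      intro z
      rw [lintegral_indicator hS]
      simp [hD.jump_compl z]
    simp only [h0, mul_zero, lintegral_zero] at h
    have hm : Measurable fun ω => discount 1 (T (n + 1) ω) *
        (D.stateSpaceᶜ).indicator (fun _ => (1 : ℝ≥0∞)) (Z (n + 1) ω) :=
      ((measurable_discount 1).comp (hX.measurable_T _)).mul
        ((measurable_const.indicator hS).comp (hX.measurable_Z _))
    rw [lintegral_eq_zero_iff hm] at h
    filter_upwards [h] with ω hω hT
    by_contra hZ
    simp [hZ, discount_eq_zero_iff, hT] at hω

theorem IsPDMPWith.lintegral_wait [IsProbabilityMeasure P] [IsProbabilityMeasure θ]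
    (hX : D.IsPDMPWith P x X T Z)
    (hD : D.IsSampledBy θ w) (hx : x ∈ D.stateSpace) (n : ℕ) {G : ℝ≥0∞ → ℝ≥0∞} (hG : Measurable G)
    (hG0 : G ⊤ = 0) (hGfin : ∀ a, G a ≤ 1)
    {F : (K × ℝ) × ℝ≥0∞ → ℝ≥0∞} (hF : Measurable F) :
    ∫⁻ ω, G (T n ω) * F (Z n ω, T (n + 1) ω - T n ω) ∂P =
      ∫⁻ ω, G (T n ω) * ∫⁻ s, F (Z n ω, w (Z n ω) s) ∂θ ∂P := by
  have hT := hX.measurable_T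
  have hZ := hX.measurable_Z
  have hGT : Measurable fun ω => G (T n ω) := hG.comp (hT _)
  have hW : Measurable fun ω => T (n + 1) ω - T n ω := (hT _).sub (hT _)
  set Q := P.withDensity fun ω => G (T n ω) with hQ
  have hQf : IsFiniteMeasure Q := isFiniteMeasure_withDensity (ne_top_of_le_ne_top
    (measure_ne_top P univ) (le_trans (lintegral_mono fun ω => hGfin _) (by simp)))
  have hw : Measurable fun p : Ω × ℝ => w (Z n p.1) p.2 :=
    hD.measurable_w.comp (((hZ n).comp measurable_fst).prodMk measurable_snd)
  have hZw : Measurable fun p : Ω × ℝ => (Z n p.1, w (Z n p.1) p.2) :=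
    ((hZ n).comp measurable_fst).prodMk hw
  have key : Q.map (fun ω => (Z n ω, T (n + 1) ω - T n ω)) =
      (Q.prod θ).map fun p => (Z n p.1, w (Z n p.1) p.2) := by
    refine Measure.ext_prod fun {B C} hB hC => ?_
    have hB' : MeasurableSet (Z n ⁻¹' B) := hZ n hB
    have hBm : (Q.restrict (Z n ⁻¹' B)).map (fun ω => T (n + 1) ω - T n ω) =
        ((Q.restrict (Z n ⁻¹' B)).prod θ).map fun p => w (Z n p.1) p.2 := by
      refine ENNReal.measure_ext_of_Ioi_ofReal ?_ fun t ht => ?_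
      · rw [Measure.map_apply hW .univ, Measure.map_apply hw .univ]
        simp [Measure.prod_apply]
      · have hA : MeasurableSet ((fun ω => T (n + 1) ω - T n ω) ⁻¹' Ioi (ENNReal.ofReal t)) :=
          hW measurableSet_Ioi
        have hA' : (fun ω => T (n + 1) ω - T n ω) ⁻¹' Ioi (ENNReal.ofReal t) =
            {ω' | T n ω' + ENNReal.ofReal t < T (n + 1) ω'} := by
          ext ω
          simp [lt_tsub_iff_left]
        have hGm : Measurable[history T Z n] ((Z n ⁻¹' B).indicator fun ω => G (T n ω)) :=
          (hG.comp (measurable_history_T le_rfl)).indicator (measurable_history_Z le_rfl hB)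
        rw [Measure.map_apply hW measurableSet_Ioi, Measure.map_apply hw measurableSet_Ioi,
          Measure.restrict_apply hA, Measure.prod_apply (hw measurableSet_Ioi), inter_comm,
          ← Measure.restrict_apply' hA, ← lintegral_indicator hB',
          lintegral_withDensity_eq_lintegral_mul _ hGT
            ((measurable_measure_prodMk_left (hw measurableSet_Ioi)).indicator hB'),
          Measure.restrict_apply hB', withDensity_apply _ (hB'.inter hA),
          ← Measure.restrict_restrict hB', ← lintegral_indicator hB',
          setLIntegral_of_condExp (κ := fun ω => D.survival (Z n ω) t) (hX.history_le n) P hA hGm]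
        · refine lintegral_congr_ae ?_
          filter_upwards [hX.ae_mem_stateSpace hD hx n] with ω hω
          by_cases hωB : ω ∈ Z n ⁻¹' B
          · by_cases hTn : T n ω = ⊤
            · simp [hωB, hTn, hG0]
            · simp only [hωB, indicator_of_mem, Pi.mul_apply]
              rw [← hD.wait_law _ (hω hTn) t ht]
              rfl
          · simp [hωB]
        · rw [hA']
          filter_upwards [hX.wait n t ht] with ω hω h0
          refine hω fun hTn => h0 ?_
          simp [indicator, hTn, hG0]
    have h1 := DFunLike.congr_fun hBm C
    rw [Measure.map_apply hW hC, Measure.map_apply hw hC, Measure.restrict_apply (hW hC),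
      Measure.prod_apply (hw hC), ← lintegral_indicator hB'] at h1
    rw [Measure.map_apply ((hZ n).prodMk hW) (hB.prod hC), Measure.map_apply hZw (hB.prod hC),
      Measure.prod_apply (hZw (hB.prod hC))]
    convert h1 using 1
    · congr 1
      ext ω
      simp [and_comm]
    · refine lintegral_congr fun ω => ?_
      by_cases hωB : Z n ω ∈ B
      · simp only [mem_preimage, hωB, indicator_of_mem]
        congr 1
        ext s
        simp [hωB]
      · rw [indicator_of_notMem (show ω ∉ Z n ⁻¹' B from hωB)]
        convert measure_empty (μ := θ)
        ext s
        simp [hωB]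
  have h1 : ∫⁻ y, F y ∂(Q.map (fun ω => (Z n ω, T (n + 1) ω - T n ω))) =
      ∫⁻ ω, G (T n ω) * F (Z n ω, T (n + 1) ω - T n ω) ∂P := by
    have hFZ : Measurable fun ω => F (Z n ω, T (n + 1) ω - T n ω) := hF.comp ((hZ n).prodMk hW)
    rw [lintegral_map hF ((hZ n).prodMk hW), lintegral_withDensity_eq_lintegral_mul _ hGT hFZ]
    rfl
  have hFw : Measurable fun p : Ω × ℝ => F (Z n p.1, w (Z n p.1) p.2) := hF.comp hZw
  rw [← h1, key, lintegral_map hF hZw, lintegral_prod _ hFw.aemeasurable,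
    lintegral_withDensity_eq_lintegral_mul _ hGT hFw.lintegral_prod_right']
  rfl

end PDMPData

/-- Locating a time between two consecutive terms of a sequence tending to infinity. -/
theorem exists_mem_Ico_of_tendsto_top {τ : ℕ → ℝ≥0∞} (h0 : τ 0 = 0)
    (h : Tendsto τ atTop (𝓝 ⊤)) (t : ℝ) :
    ∃ n, τ n ≤ ENNReal.ofReal t ∧ ENNReal.ofReal t < τ (n + 1) := by
  classical
  have hex : ∃ n, ENNReal.ofReal t < τ n := (h.eventually (lt_mem_nhds ENNReal.ofReal_lt_top)).exists
  have hpos : Nat.find hex ≠ 0 := fun h => by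
    have := Nat.find_spec hex
    simp [h, h0] at this
  obtain ⟨n, hn⟩ := Nat.exists_eq_succ_of_ne_zero hpos
  refine ⟨n, not_lt.1 (Nat.find_min hex (by omega)), ?_⟩
  have := Nat.find_spec hex
  rwa [hn] at this

theorem eq_of_mem_Ico_of_monotone {τ : ℕ → ℝ≥0∞} (h : Monotone τ) {a : ℝ≥0∞} {m n : ℕ}
    (hm : τ m ≤ a ∧ a < τ (m + 1)) (hn : τ n ≤ a ∧ a < τ (n + 1)) : m = n := by
  by_contra hne
  rcases Nat.lt_or_gt_of_ne hne with hlt | hlt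
  · exact absurd (hm.2.trans_le ((h (Nat.succ_le_of_lt hlt)).trans hn.1)) (lt_irrefl _)
  · exact absurd (hn.2.trans_le ((h (Nat.succ_le_of_lt hlt)).trans hm.1)) (lt_irrefl _)

namespace PDMPData

variable {K : Type} [MeasurableSpace K] {D : PDMPData K}

/-- The discounted reward which is collected from `z` up to a jump at the time `W`. -/
noncomputable def runningReward (D : PDMPData K) (δ : ℝ) (ell : K × ℝ → ℝ) (z : K × ℝ)
    (W : ℝ≥0∞) : ℝ≥0∞ :=
  ∫⁻ s in Ici (0 : ℝ),
    if ENNReal.ofReal s < W then ENNReal.ofReal (Real.exp (-δ * s) * ell (D.move z s)) else 0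

variable {Ω : Type*} [MeasurableSpace Ω] {P : Measure Ω} {x : K × ℝ}
  {X : ℝ → Ω → K × ℝ} {T : ℕ → Ω → ℝ≥0∞} {Z : ℕ → Ω → K × ℝ} {θ : Measure ℝ}
  {w : K × ℝ → ℝ → ℝ≥0∞} {δ : ℝ} {ell : K × ℝ → ℝ}

theorem IsSampledBy.measurable_runningReward (hD : D.IsSampledBy θ w) (hell : Measurable ell) :
    Measurable fun p : (K × ℝ) × ℝ≥0∞ => D.runningReward δ ell p.1 p.2 := by
  unfold runningReward
  have h1 : Measurable fun q : ((K × ℝ) × ℝ≥0∞) × ℝ => ENNReal.ofReal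
      (Real.exp (-δ * q.2) * ell (D.move q.1.1 q.2)) := by
    have : Measurable fun q : ((K × ℝ) × ℝ≥0∞) × ℝ => D.move q.1.1 q.2 :=
      hD.measurable_move.comp ((measurable_fst.comp measurable_fst).prodMk measurable_snd)
    fun_prop
  have hS : MeasurableSet {q : ((K × ℝ) × ℝ≥0∞) × ℝ | ENNReal.ofReal q.2 < q.1.2} :=
    measurableSet_lt (by fun_prop) (by fun_prop)
  exact (Measurable.ite hS h1 measurable_const).lintegral_prod_right'

theorem IsSampledBy.measurable_piece (hD : D.IsSampledBy θ w) (hell : Measurable ell)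
    (a a' : ℝ≥0∞) (z : K × ℝ) :
    Measurable fun t : ℝ => if a ≤ ENNReal.ofReal t ∧ ENNReal.ofReal t < a' then
      ENNReal.ofReal (Real.exp (-δ * t) * ell (D.move z (t - a.toReal))) else 0 := by
  have hmove : Measurable fun t => D.move z (t - a.toReal) :=
    hD.measurable_move.comp (measurable_const.prodMk (measurable_id.sub_const _))
  have h1 : MeasurableSet {t : ℝ | a ≤ ENNReal.ofReal t} :=
    measurableSet_le measurable_const (by fun_prop)
  have h2 : MeasurableSet {t : ℝ | ENNReal.ofReal t < a'} :=
    measurableSet_lt (by fun_prop) measurable_const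
  exact Measurable.ite (h1.inter h2) (by fun_prop) measurable_const

theorem reward_eq_tsum {τ : ℕ → ℝ≥0∞} {ζ : ℕ → K × ℝ} {ξ : ℝ → K × ℝ} (h0 : τ 0 = 0)
    (hmono : Monotone τ) (htop : Tendsto τ atTop (𝓝 ⊤))
    (hpath : ∀ (n : ℕ) (t : ℝ), 0 ≤ t → τ n ≤ ENNReal.ofReal t →
      ENNReal.ofReal t < τ (n + 1) → ξ t = D.move (ζ n) (t - (τ n).toReal))
    {t : ℝ} (ht : 0 ≤ t) :
    ENNReal.ofReal (Real.exp (-δ * t) * ell (ξ t)) =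
      ∑' n, if τ n ≤ ENNReal.ofReal t ∧ ENNReal.ofReal t < τ (n + 1) then
        ENNReal.ofReal (Real.exp (-δ * t) * ell (D.move (ζ n) (t - (τ n).toReal))) else 0 := by
  obtain ⟨n, hn⟩ := exists_mem_Ico_of_tendsto_top h0 htop t
  rw [tsum_eq_single n]
  · rw [if_pos hn, hpath n t ht hn.1 hn.2]
  · intro m hm
    rw [if_neg fun h => hm (eq_of_mem_Ico_of_monotone hmono h hn)]

theorem IsSampledBy.setLIntegral_piece (hD : D.IsSampledBy θ w) (hell : Measurable ell)
    (a a' : ℝ≥0∞) (z : K × ℝ) :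
    (∫⁻ t in Ici (0 : ℝ), if a ≤ ENNReal.ofReal t ∧ ENNReal.ofReal t < a' then
        ENNReal.ofReal (Real.exp (-δ * t) * ell (D.move z (t - a.toReal))) else 0) =
      discount δ a * D.runningReward δ ell z (a' - a) := by
  by_cases ha : a = ⊤
  · simp [ha, discount]
  have hmove : Measurable fun t => D.move z t := hD.measurable_move.comp measurable_prodMk_left
  have hm : Measurable fun s : ℝ => if ENNReal.ofReal s < a' - a then
      ENNReal.ofReal (Real.exp (-δ * s) * ell (D.move z s)) else 0 :=
    Measurable.ite (measurableSet_lt (by fun_prop) (by fun_prop)) (by fun_prop) measurable_const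
  unfold runningReward
  rw [← lintegral_const_mul _ hm, ← lintegral_indicator measurableSet_Ici,
    ← lintegral_indicator measurableSet_Ici,
    ← lintegral_add_right_eq_self (μ := volume) _ a.toReal]
  refine lintegral_congr fun s => ?_
  have ha0 : 0 ≤ a.toReal := ENNReal.toReal_nonneg
  by_cases hs : 0 ≤ s
  · have h1 : ENNReal.ofReal (s + a.toReal) = ENNReal.ofReal s + a := by
      rw [ENNReal.ofReal_add hs ha0, ENNReal.ofReal_toReal ha]
    have h2 : ENNReal.ofReal s + a < a' ↔ ENNReal.ofReal s < a' - a := lt_tsub_iff_right.symm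
    rw [indicator_of_mem (mem_Ici.2 (by linarith)), indicator_of_mem (mem_Ici.2 hs), h1,
      add_sub_cancel_right]
    simp only [le_add_self, true_and, h2]
    split_ifs
    · rw [discount, if_neg ha, ← ENNReal.ofReal_mul (Real.exp_nonneg _), ← mul_assoc,
        ← Real.exp_add]
      ring_nf
    · simp
  · rw [indicator_of_notMem (show s ∉ Ici (0 : ℝ) from hs)]
    by_cases hs' : 0 ≤ s + a.toReal
    · rw [indicator_of_mem (mem_Ici.2 hs'), if_neg]
      rintro ⟨h, -⟩
      have := (ENNReal.le_ofReal_iff_toReal_le ha hs').1 h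
      exact hs (by linarith)
    · rw [indicator_of_notMem (show s + a.toReal ∉ Ici (0 : ℝ) from hs')]

theorem IsPDMPWith.ae_lintegral_reward (hX : D.IsPDMPWith P x X T Z) (hD : D.IsSampledBy θ w)
    (hell : Measurable ell) :
    ∀ᵐ ω ∂P, ∫⁻ t in Ici (0 : ℝ), ENNReal.ofReal (Real.exp (-δ * t) * ell (X t ω)) =
      ∑' n, discount δ (T n ω) * D.runningReward δ ell (Z n ω) (T (n + 1) ω - T n ω) := by
  filter_upwards [hX.T_zero, hX.T_mono, hX.T_tendsto, hX.path] with ω h0 hmono htop hpath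
  rw [setLIntegral_congr_fun measurableSet_Ici fun t ht => reward_eq_tsum (δ := δ) (ell := ell)
    (τ := fun n => T n ω) (ζ := fun n => Z n ω) (ξ := fun t => X t ω)
    h0 (monotone_nat_of_le_succ hmono) htop hpath ht, lintegral_tsum]
  · exact tsum_congr fun n => hD.setLIntegral_piece hell _ _ _
  · intro n
    exact (hD.measurable_piece hell _ _ _).aemeasurable

variable [IsProbabilityMeasure P]

/-- A bounded function which satisfies the one-step equation is the expected discounted reward. -/
theorem IsPDMPWith.lintegral_reward [IsProbabilityMeasure θ] (hX : D.IsPDMPWith P x X T Z)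
    (hD : D.IsSampledBy θ w) (hx : x ∈ D.stateSpace) (hδ : 0 < δ) (hell : Measurable ell)
    {v : K × ℝ → ℝ≥0∞} (hv : Measurable v) {M : ℝ≥0∞} (hM : M ≠ ⊤) (hvM : ∀ z, v z ≤ M)
    (hstep : ∀ z ∈ D.stateSpace, v z = ∫⁻ s, (D.runningReward δ ell z (w z s) +
      discount δ (w z s) * ∫⁻ y, v y ∂(D.jump (D.move z (w z s).toReal))) ∂θ) :
    ∫⁻ ω, (∫⁻ t in Ici (0 : ℝ), ENNReal.ofReal (Real.exp (-δ * t) * ell (X t ω))) ∂P = v x := by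
  have hT := hX.measurable_T
  have hZ := hX.measurable_Z
  have hdT : ∀ n, Measurable fun ω => discount δ (T n ω) :=
    fun n => (measurable_discount δ).comp (hT n)
  have hrun := hD.measurable_runningReward (δ := δ) hell
  have hrunT : ∀ n, Measurable fun ω =>
      discount δ (T n ω) * D.runningReward δ ell (Z n ω) (T (n + 1) ω - T n ω) := fun n =>
    (hdT n).mul (hrun.comp ((hZ n).prodMk ((hT _).sub (hT _))))
  have hJ : Measurable fun p : (K × ℝ) × ℝ≥0∞ => ∫⁻ y, v y ∂(D.jump (D.move p.1 p.2.toReal)) :=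
    (Measure.measurable_lintegral hv).comp (hD.measurable_jump.comp (hD.measurable_move.comp
      (measurable_fst.prodMk measurable_snd.ennreal_toReal)))
  set F : (K × ℝ) × ℝ≥0∞ → ℝ≥0∞ := fun p => D.runningReward δ ell p.1 p.2 +
    discount δ p.2 * ∫⁻ y, v y ∂(D.jump (D.move p.1 p.2.toReal)) with hF
  have hFm : Measurable F :=
    hrun.add (((measurable_discount δ).comp measurable_snd).mul hJ)
  set a : ℕ → ℝ≥0∞ := fun n => ∫⁻ ω, discount δ (T n ω) * v (Z n ω) ∂P with ha
  set r : ℕ → ℝ≥0∞ := fun n => ∫⁻ ω, discount δ (T n ω) *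
    D.runningReward δ ell (Z n ω) (T (n + 1) ω - T n ω) ∂P with hr
  have step : ∀ n, a n = r n + a (n + 1) := by
    intro n
    have h1 : a n = ∫⁻ ω, discount δ (T n ω) * F (Z n ω, T (n + 1) ω - T n ω) ∂P := by
      rw [hX.lintegral_wait hD hx n (measurable_discount δ) (discount_top δ) (discount_le_one hδ)
        hFm]
      refine lintegral_congr_ae ?_
      filter_upwards [hX.ae_mem_stateSpace hD hx n] with ω hω
      by_cases hTn : T n ω = ⊤
      · simp [hTn, discount_top]
      · rw [hstep _ (hω hTn)]
    rw [h1, ha, hr]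
    simp only
    rw [hX.lintegral_jump hD n (measurable_discount δ) (discount_top δ) hv,
      ← lintegral_add_left (hrunT n)]
    refine lintegral_congr_ae ?_
    filter_upwards [hX.T_mono] with ω hω
    have hadd : discount δ (T (n + 1) ω) =
        discount δ (T n ω) * discount δ (T (n + 1) ω - T n ω) := by
      rw [← discount_add, add_tsub_cancel_of_le (hω n)]
    simp only [hF, hadd]
    ring
  have hsum : ∀ n, ∑ i ∈ Finset.range n, r i + a n = v x := by
    intro n
    induction n with
    | zero =>
      simp only [Finset.range_zero, Finset.sum_empty, zero_add, ha]
      have : ∀ᵐ ω ∂P, discount δ (T 0 ω) * v (Z 0 ω) = v x := by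
        filter_upwards [hX.T_zero, hX.Z_zero] with ω h1 h2
        simp [h1, h2, discount_zero]
      rw [lintegral_congr_ae this]
      simp
    | succ n ih => rw [Finset.sum_range_succ, add_assoc, ← step, ih]
  have hlim : Tendsto a atTop (𝓝 0) := by
    have h := tendsto_lintegral_of_dominated_convergence (μ := P) (fun _ => M)
      (F := fun n ω => discount δ (T n ω) * v (Z n ω)) (f := fun _ => 0)
      (fun n => (hdT n).mul (hv.comp (hZ n))) (fun n => ae_of_all _ fun ω =>
        (mul_le_mul' (discount_le_one hδ _) (hvM _)).trans (one_mul M).le) (by simpa using hM) ?_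
    · simpa using h
    · filter_upwards [hX.T_tendsto] with ω hω
      have h1 : Tendsto (fun n => discount δ (T n ω) * M) atTop (𝓝 0) := by
        have := ENNReal.Tendsto.mul_const ((tendsto_discount_top hδ).comp hω)
          (Or.inr hM)
        simpa using this
      exact tendsto_of_tendsto_of_tendsto_of_le_of_le tendsto_const_nhds h1 (fun _ => zero_le)
        fun n => mul_le_mul' le_rfl (hvM _)
  rw [lintegral_congr_ae (hX.ae_lintegral_reward hD hell),
    lintegral_tsum fun n => (hrunT n).aemeasurable]
  have h2 := (ENNReal.tendsto_nat_tsum r).add hlim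
  simp only [hsum, add_zero] at h2
  exact tendsto_nhds_unique h2 tendsto_const_nhds

theorem IsPDMPWith.expectedReward_eq [IsProbabilityMeasure θ] (hX : D.IsPDMPWith P x X T Z)
    (hD : D.IsSampledBy θ w) (hx : x ∈ D.stateSpace) (hδ : 0 < δ) (hell : Measurable ell)
    (hell0 : ∀ z, 0 ≤ ell z) {A : Set (K × ℝ)} (hA : MeasurableSet A)
    (hAell : ∀ z ∈ A, ell z = 0) (hAmove : ∀ z t, D.move z t ∈ A ↔ z ∈ A)
    (hAw : ∀ z ∈ A, ∀ s, w z s = ⊤)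
    {v : K × ℝ → ℝ≥0∞} (hv : Measurable v) {M : ℝ≥0∞} (hM : M ≠ ⊤) (hvM : ∀ z, v z ≤ M)
    (hstep : ∀ z ∈ D.stateSpace, v z = ∫⁻ s, (D.runningReward δ ell z (w z s) +
      discount δ (w z s) * ∫⁻ y, v y ∂(D.jump (D.move z (w z s).toReal))) ∂θ) :
    expectedReward P X δ ell A = (v x).toReal := by
  have hT := hX.measurable_T
  have hZ := hX.measurable_Z
  have hv' := hX.lintegral_reward hD hx hδ hell hv hM hvM hstep
  have hstay : ∀ᵐ ω ∂P, ∀ n, T n ω ≠ ⊤ → Z n ω ∈ A → T (n + 1) ω = ⊤ := by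
    rw [ae_all_iff]
    intro n
    have hFm : Measurable fun p : (K × ℝ) × ℝ≥0∞ =>
        A.indicator (fun _ => (1 : ℝ≥0∞)) p.1 * discount δ p.2 :=
      ((measurable_const.indicator hA).comp measurable_fst).mul
        ((measurable_discount δ).comp measurable_snd)
    have h := hX.lintegral_wait hD hx n (measurable_discount δ) (discount_top δ)
      (discount_le_one hδ) hFm
    have h0 : ∀ z s, A.indicator (fun _ => (1 : ℝ≥0∞)) z * discount δ (w z s) = 0 := by
      intro z s
      by_cases hz : z ∈ A
      · rw [hAw z hz, discount_top, mul_zero]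
      · simp [hz]
    simp only [h0, lintegral_zero, mul_zero] at h
    have hm : Measurable fun ω => discount δ (T n ω) *
        (A.indicator (fun _ => (1 : ℝ≥0∞)) (Z n ω) * discount δ (T (n + 1) ω - T n ω)) :=
      ((measurable_discount δ).comp (hT n)).mul (hFm.comp ((hZ n).prodMk ((hT _).sub (hT _))))
    rw [lintegral_eq_zero_iff hm] at h
    filter_upwards [h] with ω hω h1 h2
    simp only [h2, indicator_of_mem, one_mul, Pi.zero_apply, mul_eq_zero, discount_eq_zero_iff,
      h1, false_or, ENNReal.sub_eq_top_iff] at hω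
    exact hω.1
  have hae : ∀ᵐ ω ∂P, (∫ t in {t : ℝ | 0 ≤ t ∧ ENNReal.ofReal t < entryTime X A ω},
      Real.exp (-δ * t) * ell (X t ω)) =
      (∫⁻ t in Ici (0 : ℝ), ENNReal.ofReal (Real.exp (-δ * t) * ell (X t ω))).toReal := by
    filter_upwards [hX.T_zero, hX.T_mono, hX.T_tendsto, hX.path, hstay]
      with ω h0 hmono htop hpath hst
    have habs : ∀ s t, 0 ≤ s → s ≤ t → X s ω ∈ A → X t ω ∈ A := by
      intro s t hs hst' hXs
      obtain ⟨n, hn1, hn2⟩ := exists_mem_Ico_of_tendsto_top (τ := fun n => T n ω) h0 htop s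
      rw [hpath n s hs hn1 hn2, hAmove] at hXs
      have hn3 := hst n (ne_top_of_le_ne_top ENNReal.ofReal_ne_top hn1) hXs
      rw [hpath n t (hs.trans hst') (hn1.trans (ENNReal.ofReal_le_ofReal hst'))
        (by rw [hn3]; exact ENNReal.ofReal_lt_top), hAmove]
      exact hXs
    rw [← setIntegral_eq_of_subset_of_ae_sdiff_eq_zero (t := Ici (0 : ℝ))
      measurableSet_Ici.nullMeasurableSet (fun t ht => ht.1),
      integral_eq_lintegral_of_nonneg_ae]
    · exact ae_of_all _ fun t => mul_nonneg (Real.exp_nonneg _) (hell0 _)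
    · have hm : Measurable fun t : ℝ => (∑' n, if T n ω ≤ ENNReal.ofReal t ∧
          ENNReal.ofReal t < T (n + 1) ω then ENNReal.ofReal (Real.exp (-δ * t) *
            ell (D.move (Z n ω) (t - (T n ω).toReal))) else 0).toReal := by
        exact (Measurable.tsum fun n => hD.measurable_piece hell _ _ _).ennreal_toReal
      refine hm.aestronglyMeasurable.congr ?_
      filter_upwards [ae_restrict_mem measurableSet_Ici] with t ht
      rw [← reward_eq_tsum (δ := δ) (ell := ell) (τ := fun n => T n ω) (ζ := fun n => Z n ω)
        (ξ := fun t => X t ω) h0 (monotone_nat_of_le_succ hmono) htop hpath ht,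
        ENNReal.toReal_ofReal (mul_nonneg (Real.exp_nonneg _) (hell0 _))]
    · have hne : ∀ᵐ t : ℝ, t ≠ (entryTime X A ω).toReal := by
        simp [ae_iff]
      filter_upwards [hne] with t hne ht
      have ht0 : 0 ≤ t := ht.1
      have h1 : entryTime X A ω ≤ ENNReal.ofReal t := not_lt.1 fun h => ht.2 ⟨ht0, h⟩
      have h2 : entryTime X A ω < ENNReal.ofReal t := by
        refine lt_of_le_of_ne h1 fun h => hne ?_
        rw [h, ENNReal.toReal_ofReal ht0]
      simp only [entryTime, iInf_lt_iff] at h2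
      obtain ⟨s, ⟨hs, hXs⟩, hlt⟩ := h2
      have hst' : s ≤ t := ((ENNReal.ofReal_lt_ofReal_iff_of_nonneg hs).1 hlt).le
      rw [hAell _ (habs s t hs hst' hXs), mul_zero]
  rw [expectedReward, integral_congr_ae hae]
  have hm : AEMeasurable (fun ω => ∫⁻ t in Ici (0 : ℝ),
      ENNReal.ofReal (Real.exp (-δ * t) * ell (X t ω))) P := by
    refine AEMeasurable.congr ?_ (EventuallyEq.symm (hX.ae_lintegral_reward hD hell))
    exact (Measurable.tsum fun n => ((measurable_discount δ).comp (hT n)).mul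
      ((hD.measurable_runningReward hell).comp
        ((hZ n).prodMk ((hT _).sub (hT _))))).aemeasurable
  rw [integral_toReal hm (ae_lt_top' hm (by rw [hv']; exact ne_top_of_le_ne_top hM (hvM x))), hv']

end PDMPData

/-! ### Flows of Lipschitz vector fields on the line -/

theorem IsODEFlow.continuous {g : ℝ → ℝ} {φ : ℝ → ℝ → ℝ} (hφ : IsODEFlow g φ) (y : ℝ) :
    Continuous (φ y) :=
  continuous_iff_continuousAt.2 fun t => ((hφ y).2 t).continuousAt

theorem IsODEFlow.reverse {g : ℝ → ℝ} {φ : ℝ → ℝ → ℝ} (hφ : IsODEFlow g φ) :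
    IsODEFlow (fun z => -g z) fun y t => φ y (-t) := by
  refine fun y => ⟨by simpa using (hφ y).1, fun t => ?_⟩
  have h : HasDerivAt (fun t => φ y (-t)) (g (φ y (-t)) * -1) t :=
    ((hφ y).2 (-t)).comp t (hasDerivAt_neg t)
  simpa using h

theorem IsODEFlow.dist_le {g : ℝ → ℝ} {φ : ℝ → ℝ → ℝ} (hφ : IsODEFlow g φ) {κ : ℝ≥0}
    (hg : LipschitzWith κ g) (y y' : ℝ) {t : ℝ} (ht : 0 ≤ t) :
    dist (φ y t) (φ y' t) ≤ dist y y' * Real.exp (κ * t) := by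
  have := dist_le_of_trajectories_ODE (v := fun _ => g) (f := φ y) (g := φ y') (a := 0) (b := t)
    (δ := dist y y') (fun _ => hg) (hφ.continuous y).continuousOn
    (fun s _ => ((hφ y).2 s).hasDerivWithinAt) (hφ.continuous y').continuousOn
    (fun s _ => ((hφ y').2 s).hasDerivWithinAt) (by rw [(hφ y).1, (hφ y').1]) t ⟨ht, le_rfl⟩
  simpa using this

theorem IsODEFlow.continuous_left {g : ℝ → ℝ} {φ : ℝ → ℝ → ℝ} (hφ : IsODEFlow g φ) {κ : ℝ≥0}
    (hg : LipschitzWith κ g) (t : ℝ) : Continuous fun y => φ y t := by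
  rcases le_total 0 t with ht | ht
  · exact (LipschitzWith.of_dist_le_mul (K := (Real.exp (κ * t)).toNNReal) fun y y' => by
      rw [Real.coe_toNNReal _ (Real.exp_nonneg _), mul_comm]
      exact hφ.dist_le hg y y' ht).continuous
  · refine (LipschitzWith.of_dist_le_mul (K := (Real.exp (κ * -t)).toNNReal) fun y y' => ?_).continuous
    rw [Real.coe_toNNReal _ (Real.exp_nonneg _), mul_comm]
    simpa using hφ.reverse.dist_le hg.neg y y' (neg_nonneg.2 ht)

theorem IsODEFlow.measurable {g : ℝ → ℝ} {φ : ℝ → ℝ → ℝ} (hφ : IsODEFlow g φ) {κ : ℝ≥0}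
    (hg : LipschitzWith κ g) : Measurable fun p : ℝ × ℝ => φ p.1 p.2 := by
  have := measurable_uncurry_of_continuous_of_measurable (u := fun t y => φ y t)
    (fun y => hφ.continuous y) fun t => (hφ.continuous_left hg t).measurable
  exact this.comp measurable_swap

/-- A trajectory which meets an equilibrium is constant. -/
theorem IsODEFlow.eq_of_equilibrium {g : ℝ → ℝ} {φ : ℝ → ℝ → ℝ} (hφ : IsODEFlow g φ) {κ : ℝ≥0}
    (hg : LipschitzWith κ g) {y z t₀ : ℝ} (hz : g z = 0) (h : φ y t₀ = z) (t : ℝ) : φ y t = z := by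
  have h := ODE_solution_unique_univ (v := fun _ => g) (f := φ y) (g := fun _ => z) (t₀ := t₀)
    (s := fun _ => univ) (K := κ) (fun _ => hg.lipschitzOnWith) (fun s => ⟨(hφ y).2 s, trivial⟩)
    (fun s => ⟨by simpa [hz] using hasDerivAt_const s z, trivial⟩) h
  rw [h]

theorem IsODEFlow.monotone {g : ℝ → ℝ} {φ : ℝ → ℝ → ℝ} (hφ : IsODEFlow g φ) (hg : ∀ y, 0 ≤ g y)
    (y : ℝ) : Monotone (φ y) := by
  refine monotone_of_deriv_nonneg (fun t => ((hφ y).2 t).differentiableAt) fun t => ?_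
  rw [((hφ y).2 t).deriv]
  exact hg _

/-- A subsolution which starts below a supersolution stays below it. -/
theorem le_of_subsolution_of_supersolution {g : ℝ → ℝ} {κ : ℝ≥0} (hg : LipschitzWith κ g)
    {u u' z z' : ℝ → ℝ} {a b : ℝ} (hu : ∀ t, HasDerivAt u (u' t) t)
    (hz : ∀ t, HasDerivAt z (z' t) t) (hsub : ∀ t ∈ Ico a b, u' t ≤ g (u t))
    (hsuper : ∀ t ∈ Ico a b, g (z t) ≤ z' t) (ha : u a ≤ z a) {t : ℝ} (ht : t ∈ Icc a b) :
    u t ≤ z t := by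
  have key : ∀ η : ℝ, 0 < η → u t ≤ z t + η * Real.exp ((κ + 1) * t) := by
    intro η hη
    have hB : ∀ s, HasDerivAt (fun s => z s + η * Real.exp ((κ + 1) * s))
        (z' s + η * (Real.exp ((κ + 1) * s) * (κ + 1))) s := by
      intro s
      have h1 : HasDerivAt (fun s : ℝ => ((κ : ℝ) + 1) * s) (κ + 1) s := by
        simpa using (hasDerivAt_id s).const_mul ((κ : ℝ) + 1)
      exact (hz s).add (h1.exp.const_mul η)
    refine image_le_of_deriv_right_lt_deriv_boundary (f := u) (f' := u') (a := a) (b := b)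
      (fun s _ => (hu s).continuousAt.continuousWithinAt) (fun s _ => (hu s).hasDerivWithinAt)
      ?_ hB ?_ ht
    · have := mul_pos hη (Real.exp_pos ((κ + 1) * a))
      linarith
    · intro s hs hus
      have h1 := hsub s hs
      have h2 := hsuper s hs
      have h3 := hg.dist_le_mul (u s) (z s)
      have hpos := mul_pos hη (Real.exp_pos ((κ + 1) * s))
      rw [Real.dist_eq, Real.dist_eq, hus, add_sub_cancel_left, abs_of_pos hpos, ← hus] at h3
      have h4 := le_abs_self (g (u s) - g (z s))
      nlinarith
  refine le_of_forall_pos_le_add fun e he => ?_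
  have hpos := Real.exp_pos ((κ + 1) * t)
  have := key (e / Real.exp ((κ + 1) * t)) (div_pos he hpos)
  rwa [div_mul_cancel₀ _ hpos.ne'] at this

theorem lintegral_deriv_le_of_bounded {u u' : ℝ → ℝ} (hu : ∀ t, HasDerivAt u (u' t) t)
    (hu' : ∀ t, 0 ≤ u' t) {B : ℝ} (hB : ∀ t, u t ≤ B) (T : ℝ) :
    ∫⁻ t in Ioi T, ENNReal.ofReal (u' t) ≤ ENNReal.ofReal (B - u T) := by
  have hmono : Monotone u := monotone_of_deriv_nonneg (fun t => (hu t).differentiableAt)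
    fun t => by rw [(hu t).deriv]; exact hu' t
  have hlim := tendsto_atTop_ciSup hmono ⟨B, by rintro _ ⟨t, rfl⟩; exact hB t⟩
  have hint := integrableOn_Ioi_deriv_of_nonneg' (a := T) (fun t _ => hu t) (fun t _ => hu' t) hlim
  rw [← ofReal_integral_eq_lintegral_ofReal hint (ae_of_all _ hu'),
    integral_Ioi_of_hasDerivAt_of_nonneg' (fun t _ => hu t) (fun t _ => hu' t) hlim]
  exact ENNReal.ofReal_le_ofReal (by linarith [ciSup_le hB])

/-! ### The drifts -/

theorem drift_eq_max_min {c ρ : ℝ} (hc : 0 < c) (hρ : 0 < ρ) (y : ℝ) :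
    drift c ρ y = max 0 (min c (c + ρ * y)) := by
  unfold drift
  have hneg : -(c / ρ) < y ↔ 0 < c + ρ * y := by
    rw [neg_lt, ← sub_pos, div_eq_mul_inv]
    constructor <;> intro h
    · have := mul_pos hρ h
      field_simp at this
      linarith
    · have := mul_pos (inv_pos.2 hρ) h
      field_simp at this ⊢
      linarith
  split_ifs with h1 h2
  · rw [min_eq_left (by nlinarith), max_eq_right hc.le]
  · have := hneg.1 h2
    rw [min_eq_right (by nlinarith), max_eq_right this.le]
  · have := not_lt.1 (mt hneg.2 h2)
    rw [min_eq_right (by linarith), max_eq_left this]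

theorem lipschitzWith_drift {c ρ : ℝ} (hc : 0 < c) (hρ : 0 < ρ) :
    LipschitzWith ρ.toNNReal (drift c ρ) := by
  have h : drift c ρ = fun y => max 0 (min c (c + ρ * y)) := funext (drift_eq_max_min hc hρ)
  rw [h]
  refine ((LipschitzWith.of_dist_le_mul fun y y' => ?_).const_min c).const_max 0
  rw [Real.dist_eq, Real.dist_eq, Real.coe_toNNReal _ hρ.le, ← abs_of_pos hρ, ← abs_mul,
    abs_of_pos hρ]
  ring_nf
  exact le_rfl

theorem drift_nonneg {c ρ : ℝ} (hc : 0 < c) (hρ : 0 < ρ) (y : ℝ) : 0 ≤ drift c ρ y := by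
  rw [drift_eq_max_min hc hρ]; exact le_max_left _ _

theorem drift_le {c ρ : ℝ} (hc : 0 < c) (hρ : 0 < ρ) (y : ℝ) : drift c ρ y ≤ c := by
  rw [drift_eq_max_min hc hρ]; exact max_le hc.le (min_le_left _ _)

/-- The transition of the smoothed drift near `0`. -/
noncomputable def loanTransition (ε y : ℝ) : ℝ := (y + 3 * ε) * (y - ε) ^ 3 / (16 * ε ^ 3)

/-- The transition of the smoothed drift near the barrier, in the coordinate `(b - y) / ε`. -/
def smoothStep (u : ℝ) : ℝ := u ^ 3 * (10 - 15 * u + 6 * u ^ 2)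

/-- The admissible parameters of the smoothed model. -/
structure SmoothingScale (c ρ b ε : ℝ) : Prop where
  premium_pos : 0 < c
  rate_pos : 0 < ρ
  pos : 0 < ε
  le_barrier : ε ≤ b / 2
  le_critical : ε ≤ c / ρ

theorem exists_lipschitzWith_comp_clamp {p : ℝ → ℝ} (hp : ContDiff ℝ 1 p) {a b : ℝ} (hab : a ≤ b) :
    ∃ κ : ℝ≥0, LipschitzWith κ fun y => p (max a (min b y)) := by
  obtain ⟨κ, hκ⟩ := (hp.locallyLipschitz.locallyLipschitzOn (s := Icc a b)).exists_lipschitzOnWith_of_compact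
    isCompact_Icc
  have hmem : ∀ y, max a (min b y) ∈ Icc a b := fun y =>
    ⟨le_max_left _ _, max_le hab (min_le_left _ _)⟩
  refine ⟨κ, LipschitzWith.of_dist_le_mul fun y y' => ?_⟩
  refine (hκ.dist_le_mul _ (hmem y) _ (hmem y')).trans (mul_le_mul_of_nonneg_left ?_ κ.2)
  simpa using ((LipschitzWith.id.const_min b).const_max a).dist_le_mul y y'

section SmoothDrift

variable {c ρ b ε : ℝ}

theorem loanTransition_neg_self (hε : 0 < ε) : loanTransition ε (-ε) = -ε := by
  unfold loanTransition
  field_simp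
  ring

theorem loanTransition_self : loanTransition ε ε = 0 := by simp [loanTransition]

theorem loanTransition_le (hε : 0 < ε) {y : ℝ} (h1 : -ε ≤ y) (h2 : y ≤ ε) : loanTransition ε y ≤ min y 0 := by
  unfold loanTransition
  have h3 : 0 ≤ (ε - y) ^ 3 := pow_nonneg (by linarith) 3
  refine le_min ?_ ?_
  · rw [div_le_iff₀ (by positivity)]
    have : y * (16 * ε ^ 3) - (y + 3 * ε) * (y - ε) ^ 3 = (y + ε) ^ 3 * (3 * ε - y) := by ring
    have h4 : 0 ≤ (y + ε) ^ 3 * (3 * ε - y) :=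
      mul_nonneg (pow_nonneg (by linarith) 3) (by linarith)
    linarith
  · rw [div_le_iff₀ (by positivity)]
    nlinarith [mul_nonneg (by linarith : 0 ≤ y + 3 * ε) h3]

theorem le_loanTransition (hε : 0 < ε) {y : ℝ} (h1 : -ε ≤ y) (h2 : y ≤ ε) : -ε ≤ loanTransition ε y := by
  unfold loanTransition
  rw [le_div_iff₀ (by positivity)]
  have h3 : (y + 3 * ε) * (y - ε) ^ 3 + ε * (16 * ε ^ 3) =
      (y + ε) ^ 4 + 4 * (y + ε) * ε * ((ε - y) * (3 * ε + y)) := by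
    ring
  have h4 : 0 ≤ 4 * (y + ε) * ε * ((ε - y) * (3 * ε + y)) :=
    mul_nonneg (mul_nonneg (by linarith) hε.le) (mul_nonneg (by linarith) (by linarith))
  linarith [pow_nonneg (by linarith : 0 ≤ y + ε) 4]

theorem smoothStep_one : smoothStep 1 = 1 := by norm_num [smoothStep]

theorem le_smoothStep {u : ℝ} (h0 : 0 ≤ u) (h1 : u ≤ 1) : u ^ 3 ≤ smoothStep u := by
  unfold smoothStep
  nlinarith [pow_nonneg h0 3, mul_nonneg (pow_nonneg h0 3) (by nlinarith : 0 ≤ 9 - 15 * u + 6 * u ^ 2)]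

theorem smoothStep_le_one {u : ℝ} (h1 : u ≤ 1) : smoothStep u ≤ 1 := by
  unfold smoothStep
  have : 1 - u ^ 3 * (10 - 15 * u + 6 * u ^ 2) = (1 - u) ^ 3 * (1 + 3 * u + 6 * u ^ 2) := by ring
  have h2 : 0 ≤ (1 - u) ^ 3 * (1 + 3 * u + 6 * u ^ 2) :=
    mul_nonneg (pow_nonneg (by linarith) 3) (by nlinarith [sq_nonneg (u + 1 / 4)])
  linarith

variable (hs : SmoothingScale c ρ b ε)
include hs

theorem smoothDrift_eq_drift {y : ℝ} (hy : y ≤ -ε) : smoothDrift c ρ b ε y = drift c ρ y := by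
  obtain ⟨hc, hρ, hε, hεb, hεc⟩ := id hs
  unfold smoothDrift drift
  rw [if_neg (fun h => by linarith [h.1]), if_neg (fun h => by linarith [h.1]),
    if_neg (by linarith : ¬ 0 < y)]
  rcases hy.lt_or_eq with h | h
  · by_cases h' : -(c / ρ) < y
    · rw [if_pos ⟨h', h⟩, if_pos h']
    · rw [if_neg (fun h => h' h.1), if_neg (fun h => by linarith [h.1]), if_neg h']
  · rw [if_neg (fun h' => by linarith [h'.2]), if_pos ⟨h.ge, by linarith⟩]
    have h1 := loanTransition_neg_self hε
    unfold loanTransition at h1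
    rw [h, mul_assoc, mul_div_assoc, h1]
    split_ifs with h2
    · rfl
    · have : c / ρ = ε := le_antisymm (by linarith) hεc
      rw [← this]
      field_simp
      ring

theorem smoothDrift_eq_loanTransition {y : ℝ} (h1 : -ε ≤ y) (h2 : y ≤ ε) :
    smoothDrift c ρ b ε y = c + ρ * loanTransition ε y := by
  obtain ⟨hc, hρ, hε, hεb, hεc⟩ := id hs
  unfold smoothDrift
  rw [if_neg (fun h => by linarith [h.1]), if_neg (fun h => by linarith [h.1]),
    if_neg (fun h => by linarith [h.2]), if_pos ⟨h1, h2⟩, loanTransition, mul_assoc, mul_div_assoc]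

theorem smoothDrift_eq_const {y : ℝ} (h1 : ε ≤ y) (h2 : y ≤ b - ε) :
    smoothDrift c ρ b ε y = c := by
  obtain ⟨hc, hρ, hε, hεb, hεc⟩ := id hs
  rcases h1.eq_or_lt with h | h
  · rw [smoothDrift_eq_loanTransition hs (by linarith) h.ge, ← h,
      loanTransition_self]
    ring
  · unfold smoothDrift
    rw [if_pos ⟨h, h2⟩]

theorem smoothDrift_eq_smoothStep {y : ℝ} (h1 : b - ε ≤ y) (h2 : y < b) :
    smoothDrift c ρ b ε y = c * smoothStep ((b - y) / ε) := by
  obtain ⟨hc, hρ, hε, hεb, hεc⟩ := id hs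
  rcases h1.eq_or_lt with h | h
  · rw [smoothDrift_eq_const hs (by linarith) h.ge, ← h, sub_sub_cancel,
      div_self hε.ne', smoothStep_one, mul_one]
  · unfold smoothDrift smoothStep
    rw [if_neg (fun h => by linarith [h.2]), if_pos ⟨h, h2⟩]
    field_simp
    ring

theorem smoothDrift_eq_zero {y : ℝ} (h : b ≤ y) : smoothDrift c ρ b ε y = 0 := by
  obtain ⟨hc, hρ, hε, hεb, hεc⟩ := id hs
  unfold smoothDrift
  rw [if_neg (fun h => by linarith [h.2]), if_neg (fun h => by linarith [h.2]),
    if_neg (fun h => by linarith [h.2]), if_neg (fun h => by linarith [h.2])]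

theorem smoothDrift_nonneg (y : ℝ) : 0 ≤ smoothDrift c ρ b ε y := by
  obtain ⟨hc, hρ, hε, hεb, hεc⟩ := id hs
  rcases le_total y (-ε) with h1 | h1
  · rw [smoothDrift_eq_drift hs h1]; exact drift_nonneg hc hρ y
  rcases le_total y ε with h2 | h2
  · rw [smoothDrift_eq_loanTransition hs h1 h2]
    have := le_loanTransition hε h1 h2
    have h3 : ρ * ε ≤ c := by rwa [le_div_iff₀' hρ] at hεc
    nlinarith
  rcases le_total y (b - ε) with h3 | h3
  · rw [smoothDrift_eq_const hs h2 h3]; exact hc.le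
  rcases lt_or_ge y b with h4 | h4
  · rw [smoothDrift_eq_smoothStep hs h3 h4]
    have h5 : 0 ≤ (b - y) / ε := div_nonneg (by linarith) hε.le
    have := le_smoothStep h5 ((div_le_one hε).2 (by linarith))
    exact mul_nonneg hc.le ((pow_nonneg h5 3).trans this)
  · rw [smoothDrift_eq_zero hs h4]

theorem smoothDrift_le_drift (y : ℝ) : smoothDrift c ρ b ε y ≤ drift c ρ y := by
  obtain ⟨hc, hρ, hε, hεb, hεc⟩ := id hs
  rcases le_total y (-ε) with h1 | h1
  · rw [smoothDrift_eq_drift hs h1]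
  rcases le_total y ε with h2 | h2
  · rw [smoothDrift_eq_loanTransition hs h1 h2, drift_eq_max_min hc hρ]
    have := loanTransition_le hε h1 h2
    refine le_max_of_le_right (le_min ?_ ?_)
    · nlinarith [this.trans (min_le_right _ _)]
    · nlinarith [this.trans (min_le_left _ _)]
  have h0 : drift c ρ y = c := by rw [drift, if_pos (by linarith)]
  rw [h0]
  rcases le_total y (b - ε) with h3 | h3
  · rw [smoothDrift_eq_const hs h2 h3]
  rcases lt_or_ge y b with h4 | h4
  · rw [smoothDrift_eq_smoothStep hs h3 h4]
    have := smoothStep_le_one ((div_le_one hε).2 (by linarith : b - y ≤ ε))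
    nlinarith
  · rw [smoothDrift_eq_zero hs h4]; exact hc.le

theorem le_mul_smoothDrift (hεc' : ε ≤ c / ρ / 2) {y : ℝ} (h1 : -ε ≤ y) (h3 : y ≤ b - ε) :
    c ≤ (1 + 2 * ρ / c * ε) * smoothDrift c ρ b ε y := by
  obtain ⟨hc, hρ, hε, hεb, hεc⟩ := id hs
  rcases le_total y ε with h2 | h2
  · rw [smoothDrift_eq_loanTransition hs h1 h2]
    have h4 := le_loanTransition hε h1 h2
    have h5 : 2 * (ρ * ε) ≤ c := by
      rw [div_div, le_div_iff₀ (by positivity)] at hεc'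
      linarith
    have h6 : c - ρ * ε ≤ c + ρ * loanTransition ε y := by nlinarith
    have h7 : 0 ≤ 2 * ρ / c * ε := by positivity
    have h8 : c ≤ (1 + 2 * ρ / c * ε) * (c - ρ * ε) := by
      have : (1 + 2 * ρ / c * ε) * (c - ρ * ε) - c = (ρ * ε) / c * (c - 2 * (ρ * ε)) := by
        field_simp
        ring
      have h9 : 0 ≤ (ρ * ε) / c * (c - 2 * (ρ * ε)) :=
        mul_nonneg (by positivity) (by linarith)
      linarith
    exact h8.trans (mul_le_mul_of_nonneg_left h6 (by linarith))
  · rw [smoothDrift_eq_const hs h2 h3]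
    have : 0 ≤ 2 * ρ / c * ε * c := by positivity
    linarith

theorem exists_lipschitzWith_smoothDrift : ∃ κ : ℝ≥0, LipschitzWith κ (smoothDrift c ρ b ε) := by
  obtain ⟨hc, hρ, hε, hεb, hεc⟩ := id hs
  obtain ⟨κ₁, h₁⟩ := exists_lipschitzWith_comp_clamp (p := loanTransition ε)
    (by unfold loanTransition; fun_prop) (by linarith : -ε ≤ ε)
  obtain ⟨κ₂, h₂⟩ := exists_lipschitzWith_comp_clamp (p := smoothStep)
    (by unfold smoothStep; fun_prop) (zero_le_one' ℝ)
  have hlin : ∀ a d : ℝ, LipschitzWith (‖a‖₊) fun y : ℝ => a * y + d := fun a d =>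
    LipschitzWith.of_dist_le_mul fun y y' => by
      rw [Real.dist_eq, Real.dist_eq, coe_nnnorm, Real.norm_eq_abs, ← abs_mul]
      ring_nf
      exact le_rfl
  have hq := ((hlin 1 ε).min_const 0).add h₁
  have hA := ((hlin ρ c).comp hq).const_max 0
  have hB := (hlin c (-c)).comp (h₂.comp (hlin (-ε⁻¹) (b / ε)))
  have key : ∀ y, smoothDrift c ρ b ε y =
      max 0 (ρ * (min (1 * y + ε) 0 + loanTransition ε (max (-ε) (min ε y))) + c) +
        (c * smoothStep (max 0 (min 1 (-ε⁻¹ * y + b / ε))) + -c) := by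
    intro y
    have hu : -ε⁻¹ * y + b / ε = (b - y) / ε := by field_simp; ring
    rw [hu, one_mul]
    rcases le_total y (b - ε) with h3 | h3
    · have h1u : 1 ≤ (b - y) / ε := (one_le_div hε).2 (by linarith)
      rw [min_eq_left h1u, max_eq_right zero_le_one, smoothStep_one]
      rcases le_total y (-ε) with h1 | h1
      · rw [smoothDrift_eq_drift hs h1, drift_eq_max_min hc hρ,
          min_eq_left (by linarith : y + ε ≤ 0), min_eq_right (by linarith : y ≤ ε),
          max_eq_left h1, loanTransition_neg_self hε,
          min_eq_right (by nlinarith : c + ρ * y ≤ c)]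
        ring_nf
      rw [min_eq_right (by linarith : (0 : ℝ) ≤ y + ε), zero_add]
      rcases le_total y ε with h2 | h2
      · have h4 := smoothDrift_nonneg hs y
        rw [smoothDrift_eq_loanTransition hs h1 h2] at h4 ⊢
        rw [min_eq_right h2, max_eq_right h1, max_eq_right (by linarith)]
        ring
      · rw [smoothDrift_eq_const hs h2 h3, min_eq_left h2, max_eq_right (by linarith : -ε ≤ ε),
          loanTransition_self, max_eq_right (by linarith)]
        ring
    · rw [min_eq_right (by linarith : (0 : ℝ) ≤ y + ε), min_eq_left (by linarith : ε ≤ y),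
        max_eq_right (by linarith : -ε ≤ ε), loanTransition_self, add_zero, mul_zero, zero_add,
        max_eq_right hc.le, min_eq_right ((div_le_one hε).2 (by linarith))]
      rcases lt_or_ge y b with h4 | h4
      · rw [smoothDrift_eq_smoothStep hs h3 h4, max_eq_right (div_nonneg (by linarith) hε.le)]
        ring
      · rw [smoothDrift_eq_zero hs h4, max_eq_left (div_nonpos_of_nonpos_of_nonneg (by linarith) hε.le)]
        simp [smoothStep]
  refine ⟨‖ρ‖₊ * (‖(1 : ℝ)‖₊ + κ₁) + ‖c‖₊ * (κ₂ * ‖-ε⁻¹‖₊), fun y y' => ?_⟩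
  rw [key, key]
  exact (hA.add hB) y y'

end SmoothDrift

/-! ### Exponential waiting times -/

theorem setLIntegral_exp_Ici {κ : ℝ} (hκ : 0 < κ) (τ : ℝ) :
    ∫⁻ s in Ici τ, ENNReal.ofReal (Real.exp (-κ * s)) = ENNReal.ofReal (Real.exp (-κ * τ) / κ) := by
  rw [setLIntegral_congr Ioi_ae_eq_Ici.symm, ← ofReal_integral_eq_lintegral_ofReal
    (integrableOn_exp_mul_Ioi (neg_neg_of_pos hκ) τ) (ae_of_all _ fun _ => Real.exp_nonneg _),
    integral_exp_mul_Ioi (neg_neg_of_pos hκ), neg_div_neg_eq]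

/-- The exponential law with rate `lam`. -/
noncomputable def exponentialClock (lam : ℝ) : Measure ℝ :=
  (volume.restrict (Ici 0)).withDensity fun s => ENNReal.ofReal (lam * Real.exp (-lam * s))

theorem lintegral_exponentialClock (lam : ℝ) {F : ℝ → ℝ≥0∞} (hF : Measurable F) :
    ∫⁻ s, F s ∂(exponentialClock lam) =
      ∫⁻ s in Ici (0 : ℝ), ENNReal.ofReal (lam * Real.exp (-lam * s)) * F s := by
  rw [exponentialClock, lintegral_withDensity_eq_lintegral_mul _ (by fun_prop) hF]
  rfl

theorem setLIntegral_exponential_density {lam : ℝ} (hlam : 0 < lam) (τ : ℝ) :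
    ∫⁻ s in Ici τ, ENNReal.ofReal (lam * Real.exp (-lam * s)) =
      ENNReal.ofReal (Real.exp (-lam * τ)) := by
  simp_rw [ENNReal.ofReal_mul hlam.le]
  rw [lintegral_const_mul _ (by fun_prop), setLIntegral_exp_Ici hlam, ← ENNReal.ofReal_mul hlam.le,
    mul_div_cancel₀ _ hlam.ne']

theorem exponentialClock_Ioi {lam : ℝ} (hlam : 0 < lam) {t : ℝ} (ht : 0 ≤ t) :
    exponentialClock lam (Ioi t) = ENNReal.ofReal (Real.exp (-lam * t)) := by
  rw [exponentialClock, withDensity_apply _ measurableSet_Ioi,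
    Measure.restrict_restrict measurableSet_Ioi,
    inter_eq_left.2 (Ioi_subset_Ici ht : Ioi t ⊆ Ici 0), setLIntegral_congr Ioi_ae_eq_Ici,
    setLIntegral_exponential_density hlam]

theorem isProbabilityMeasure_exponentialClock {lam : ℝ} (hlam : 0 < lam) :
    IsProbabilityMeasure (exponentialClock lam) := by
  refine ⟨?_⟩
  rw [exponentialClock, withDensity_apply _ .univ, Measure.restrict_univ,
    setLIntegral_exponential_density hlam]
  simp

theorem PDMPData.IsSampledBy.lintegral_runningReward {K : Type} [MeasurableSpace K]
    {D : PDMPData K} {θ : Measure ℝ} [IsProbabilityMeasure θ] {w : K × ℝ → ℝ → ℝ≥0∞}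
    (hD : D.IsSampledBy θ w) {ell : K × ℝ → ℝ} (hell : Measurable ell) (δ : ℝ) {z : K × ℝ}
    (hz : z ∈ D.stateSpace) :
    ∫⁻ s, D.runningReward δ ell z (w z s) ∂θ = ∫⁻ t in Ici (0 : ℝ),
      ENNReal.ofReal (Real.exp (-δ * t) * ell (D.move z t)) * ENNReal.ofReal (D.survival z t) := by
  unfold PDMPData.runningReward
  have hw : Measurable (w z) := hD.measurable_w.comp measurable_prodMk_left
  have hmove : Measurable fun t => D.move z t := hD.measurable_move.comp measurable_prodMk_left
  have hS : MeasurableSet {q : ℝ × ℝ | ENNReal.ofReal q.2 < w z q.1} :=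
    measurableSet_lt (by fun_prop) (by fun_prop)
  rw [lintegral_lintegral_swap]
  · refine setLIntegral_congr_fun measurableSet_Ici fun t ht => ?_
    have hSt : MeasurableSet {s : ℝ | ENNReal.ofReal t < w z s} :=
      measurableSet_lt measurable_const hw
    have : ∀ s, (if ENNReal.ofReal t < w z s then
        ENNReal.ofReal (Real.exp (-δ * t) * ell (D.move z t)) else 0) =
        {s : ℝ | ENNReal.ofReal t < w z s}.indicator
          (fun _ => ENNReal.ofReal (Real.exp (-δ * t) * ell (D.move z t))) s := fun s => by
      simp [indicator]
    simp only [this]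
    rw [lintegral_indicator_const hSt, hD.wait_law z hz t ht]
  · refine Measurable.aemeasurable ?_
    exact Measurable.ite hS (by fun_prop) measurable_const

/-! ### The hitting time of the barrier -/

/-- The time at which the monotone trajectory from `y` reaches `b`. -/
noncomputable def hitTime (b : ℝ) (φ : ℝ → ℝ → ℝ) (y : ℝ) : ℝ≥0∞ :=
  ⨆ q : ℚ, if φ y q < b then ENNReal.ofReal q else 0

/-- The properties of the flow which the model relies on. -/
structure IsUpwardFlow (φ : ℝ → ℝ → ℝ) : Prop where
  zero : ∀ y, φ y 0 = y
  continuous : ∀ y, Continuous (φ y)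
  monotone : ∀ y, Monotone (φ y)
  measurable : Measurable fun p : ℝ × ℝ => φ p.1 p.2

theorem IsODEFlow.isUpwardFlow {g : ℝ → ℝ} {φ : ℝ → ℝ → ℝ} (hφ : IsODEFlow g φ) {κ : ℝ≥0}
    (hg : LipschitzWith κ g) (hg0 : ∀ y, 0 ≤ g y) : IsUpwardFlow φ :=
  ⟨fun y => (hφ y).1, hφ.continuous, hφ.monotone hg0, hφ.measurable hg⟩

namespace IsUpwardFlow

variable {φ : ℝ → ℝ → ℝ} (hφ : IsUpwardFlow φ) {b : ℝ}
include hφ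

theorem measurable_right (y : ℝ) : Measurable (φ y) := (hφ.continuous y).measurable

theorem measurable_left (t : ℝ) : Measurable fun y => φ y t :=
  hφ.measurable.comp measurable_prodMk_right

theorem le_apply (y : ℝ) {t : ℝ} (ht : 0 ≤ t) : y ≤ φ y t := by
  simpa [hφ.zero] using hφ.monotone y ht

theorem measurable_hitTime : Measurable (hitTime b φ) :=
  Measurable.iSup fun q => Measurable.ite
    (measurableSet_lt (hφ.measurable_left q) measurable_const) measurable_const measurable_const

theorem lt_hitTime_iff {y t : ℝ} (ht : 0 ≤ t) : ENNReal.ofReal t < hitTime b φ y ↔ φ y t < b := by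
  rw [hitTime, lt_iSup_iff]
  constructor
  · rintro ⟨q, hq⟩
    split_ifs at hq with h
    · exact (hφ.monotone y ((ENNReal.ofReal_lt_ofReal_iff_of_nonneg ht).1 hq).le).trans_lt h
    · simp at hq
  · intro h
    have h1 : ∀ᶠ s in 𝓝[>] t, φ y s < b :=
      nhdsWithin_le_nhds (((hφ.continuous y).tendsto t).eventually (gt_mem_nhds h))
    obtain ⟨s, hs, hts⟩ := (h1.and self_mem_nhdsWithin).exists
    obtain ⟨q, hq1, hq2⟩ := exists_rat_btwn (show t < s from hts)
    refine ⟨q, ?_⟩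
    rw [if_pos ((hφ.monotone y hq2.le).trans_lt hs)]
    exact (ENNReal.ofReal_lt_ofReal_iff_of_nonneg ht).2 hq1

theorem hitTime_le_iff {y t : ℝ} (ht : 0 ≤ t) : hitTime b φ y ≤ ENNReal.ofReal t ↔ b ≤ φ y t := by
  rw [← not_lt, ← not_lt, hφ.lt_hitTime_iff ht]

theorem apply_hitTime {y : ℝ} (hy : y < b) (h : hitTime b φ y ≠ ⊤) :
    φ y (hitTime b φ y).toReal = b := by
  set τ := (hitTime b φ y).toReal with hτ
  have hτ0 : 0 ≤ τ := ENNReal.toReal_nonneg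
  have h1 : b ≤ φ y τ := (hφ.hitTime_le_iff hτ0).1 (by rw [hτ, ENNReal.ofReal_toReal h])
  refine le_antisymm (not_lt.1 fun hlt => ?_) h1
  have hpos : 0 < τ := by
    refine hτ0.lt_of_ne fun h0 => ?_
    rw [← h0, hφ.zero] at h1
    linarith
  have h2 : ∀ᶠ s in 𝓝[<] τ, b < φ y s :=
    nhdsWithin_le_nhds (((hφ.continuous y).tendsto τ).eventually (lt_mem_nhds hlt))
  have h3 : ∀ᶠ s in 𝓝[<] τ, 0 < s := nhdsWithin_le_nhds (lt_mem_nhds hpos)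
  obtain ⟨s, ⟨hs1, hs2⟩, hs3⟩ := ((h2.and h3).and self_mem_nhdsWithin).exists
  have h4 := (hφ.hitTime_le_iff hs2.le).2 hs1.le
  have h5 := ENNReal.toReal_le_of_le_ofReal hs2.le h4
  exact absurd h5 (not_le.2 hs3)

end IsUpwardFlow

/-! ### Claims -/

theorem measurable_ofReal_claimDensity {f : ℝ → ℝ} (hf : IsClaimDensity f) :
    AEMeasurable (fun y => ENNReal.ofReal (f y)) (volume.restrict (Ici 0)) :=
  (hf.contDiffOn.continuousOn.aemeasurable measurableSet_Ici).ennreal_ofReal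

theorem isProbabilityMeasure_claimLaw {f : ℝ → ℝ} (hf : IsClaimDensity f) :
    IsProbabilityMeasure (claimLaw f) := by
  refine ⟨?_⟩
  have hint : IntegrableOn f (Ici 0) := by
    by_contra h
    have := hf.integral_eq_one
    rw [integral_undef h] at this
    exact zero_ne_one this
  rw [claimLaw, withDensity_apply _ .univ, Measure.restrict_univ,
    ← ofReal_integral_eq_lintegral_ofReal hint
      ((ae_restrict_iff' measurableSet_Ici).2 (ae_of_all _ hf.nonneg)), hf.integral_eq_one,
    ENNReal.ofReal_one]

theorem ae_nonneg_claimLaw (f : ℝ → ℝ) : ∀ᵐ y ∂(claimLaw f), 0 ≤ y :=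
  (withDensity_absolutelyContinuous _ _).ae_le (ae_restrict_mem measurableSet_Ici)

/-- The expected value of `u` after a claim at the surplus `z`. -/
noncomputable def afterClaim (f : ℝ → ℝ) (u : ℝ → ℝ≥0∞) (z : ℝ) : ℝ≥0∞ :=
  ∫⁻ y, u (z - y) ∂(claimLaw f)

theorem measurable_afterClaim {f : ℝ → ℝ} (hf : IsClaimDensity f) {u : ℝ → ℝ≥0∞}
    (hu : Measurable u) : Measurable (afterClaim f u) := by
  have := isProbabilityMeasure_claimLaw hf
  exact (hu.comp (measurable_fst.sub measurable_snd)).lintegral_prod_right'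

section Jump

variable {c ρ b : ℝ} {f : ℝ → ℝ}

theorem measurableSet_phaseDom (k : Phase) : MeasurableSet (phaseDom c ρ b k) := by
  cases k
  · exact measurableSet_Ioo
  · exact measurableSet_Iio
  · exact measurableSet_singleton _
  · exact measurableSet_singleton _

theorem claimJump_of_ne {x : Phase × ℝ} (hx : x ≠ (Phase.active, b)) :
    claimJump c ρ b f x = ∑ j : Phase,
      (((claimLaw f).map fun z => x.2 - z).restrict (phaseDom c ρ b j)).map (Prod.mk j) := by
  rw [claimJump, if_neg hx]

theorem claimJump_barrier_hit :
    claimJump c ρ b f (Phase.active, b) = Measure.dirac (Phase.barrier, b) := by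
  rw [claimJump, if_pos rfl]

theorem measurable_claimJump (hf : IsClaimDensity f) : Measurable (claimJump c ρ b f) := by
  have := isProbabilityMeasure_claimLaw hf
  refine Measurable.ite (measurableSet_singleton _) measurable_const ?_
  refine Measure.measurable_of_measurable_coe _ fun A hA => ?_
  simp only [Measure.coe_finsetSum, Finset.sum_apply]
  refine Finset.measurable_sum _ fun j _ => ?_
  have hjA : MeasurableSet (Prod.mk j ⁻¹' A ∩ phaseDom c ρ b j) :=
    (measurable_prodMk_left hA).inter (measurableSet_phaseDom j)
  have : ∀ x : Phase × ℝ, (((claimLaw f).map fun z => x.2 - z).restrict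
      (phaseDom c ρ b j)).map (Prod.mk j) A = claimLaw f (Prod.mk x ⁻¹'
        ((fun p : (Phase × ℝ) × ℝ => p.1.2 - p.2) ⁻¹' (Prod.mk j ⁻¹' A ∩ phaseDom c ρ b j))) := by
    intro x
    rw [Measure.map_apply measurable_prodMk_left hA,
      Measure.restrict_apply (measurable_prodMk_left hA), Measure.map_apply (by fun_prop) hjA]
    rfl
  simp only [this]
  exact measurable_measure_prodMk_left ((by fun_prop : Measurable fun p : (Phase × ℝ) × ℝ =>
    p.1.2 - p.2) hjA)

theorem isFiniteMeasure_claimJump (hf : IsClaimDensity f) (x : Phase × ℝ) :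
    IsFiniteMeasure (claimJump c ρ b f x) := by
  have := isProbabilityMeasure_claimLaw hf
  unfold claimJump
  split_ifs <;> infer_instance

theorem claimJump_compl (φ : ℝ → ℝ → ℝ) (lam : ℝ) (x : Phase × ℝ)
    (hS : MeasurableSet (loanModel c ρ b lam f φ).stateSpace) :
    claimJump c ρ b f x (loanModel c ρ b lam f φ).stateSpaceᶜ = 0 := by
  by_cases hx : x = (Phase.active, b)
  · rw [hx, claimJump_barrier_hit, Measure.dirac_apply' _ hS.compl, indicator_of_notMem]
    simp [PDMPData.stateSpace, loanModel, phaseDom]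
  · rw [claimJump_of_ne hx, Measure.coe_finsetSum, Finset.sum_apply]
    refine Finset.sum_eq_zero fun j _ => ?_
    rw [Measure.map_apply measurable_prodMk_left hS.compl,
      Measure.restrict_apply (measurable_prodMk_left hS.compl)]
    convert measure_empty (μ := (claimLaw f).map fun z => x.2 - z)
    ext y
    simp [PDMPData.stateSpace, loanModel]

theorem lintegral_claimJump_of_ne (hc : 0 < c) (hρ : 0 < ρ) (hb : 0 < b) {u : ℝ → ℝ≥0∞}
    (hu : Measurable u) {x : Phase × ℝ}
    (hx : x ≠ (Phase.active, b)) (hxb : x.2 ≤ b) :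
    ∫⁻ y, u y.2 ∂(claimJump c ρ b f x) = afterClaim f u x.2 := by
  have hm : Measurable fun z : ℝ => x.2 - z := by fun_prop
  have hcρ : 0 < c / ρ := div_pos hc hρ
  rw [claimJump_of_ne hx, lintegral_finsetSum_measure]
  have h1 : ∀ j : Phase, ∫⁻ y, u y.2 ∂((((claimLaw f).map fun z => x.2 - z).restrict
      (phaseDom c ρ b j)).map (Prod.mk j)) =
      ∫⁻ z, (phaseDom c ρ b j).indicator u (x.2 - z) ∂(claimLaw f) := by
    intro j
    rw [lintegral_map (by fun_prop) measurable_prodMk_left,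
      ← lintegral_indicator (measurableSet_phaseDom j),
      lintegral_map (hu.indicator (measurableSet_phaseDom j)) hm]
  simp only [h1]
  have h2 : ∀ j : Phase, Measurable fun z => (phaseDom c ρ b j).indicator u (x.2 - z) := fun j =>
    (hu.indicator (measurableSet_phaseDom j)).comp hm
  rw [← lintegral_finsetSum _ fun j _ => h2 j, afterClaim]
  refine lintegral_congr_ae ?_
  filter_upwards [ae_nonneg_claimLaw f] with z hz
  have huniv : (Finset.univ : Finset Phase) = {.active, .ruined, .critical, .barrier} := rfl
  rw [huniv]
  simp only [Finset.mem_insert, Finset.mem_singleton, reduceCtorEq, or_self, not_false_eq_true,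
    Finset.sum_insert, Finset.sum_singleton, phaseDom, indicator, mem_Ioo, mem_Iio,
    mem_singleton_iff]
  have hle : x.2 - z ≤ b := by linarith
  rcases lt_trichotomy (x.2 - z) (-(c / ρ)) with h | h | h
  · rw [if_neg (fun h' => by linarith [h'.1]), if_pos h, if_neg h.ne, if_neg (by linarith)]
    simp
  · rw [if_neg (fun h' => by linarith [h'.1]), if_neg h.ge.not_gt, if_pos h,
      if_neg (by linarith)]
    simp
  · rcases hle.lt_or_eq with h' | h'
    · rw [if_pos ⟨h, h'⟩, if_neg h.le.not_gt, if_neg h.ne', if_neg h'.ne]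
      simp
    · rw [if_neg (fun h'' => by linarith [h''.2]), if_neg h.le.not_gt, if_neg h.ne', if_pos h']
      simp

end Jump

/-! ### The model as a sampled process -/

/-- The waiting time for the next jump from the state `z`, as a function of the ring time `s` of an
exponential clock. -/
noncomputable def waitingTime (b : ℝ) (φ : ℝ → ℝ → ℝ) (z : Phase × ℝ) (s : ℝ) : ℝ≥0∞ :=
  if z.1 = Phase.active then min (ENNReal.ofReal s) (hitTime b φ z.2)
  else if z.1 = Phase.barrier then ENNReal.ofReal s else ⊤

section Model

variable {c ρ b lam δ : ℝ} {f : ℝ → ℝ} {φ : ℝ → ℝ → ℝ}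

theorem measurableSet_phase_eq (k : Phase) : MeasurableSet {z : Phase × ℝ | z.1 = k} :=
  measurable_fst (measurableSet_singleton k)

theorem measurable_waitingTime (hφ : IsUpwardFlow φ) :
    Measurable (Function.uncurry (waitingTime b φ)) := by
  have h1 : Measurable fun p : (Phase × ℝ) × ℝ => ENNReal.ofReal p.2 := by fun_prop
  have h2 : Measurable fun p : (Phase × ℝ) × ℝ => hitTime b φ p.1.2 :=
    hφ.measurable_hitTime.comp (measurable_snd.comp measurable_fst)
  exact Measurable.ite (measurable_fst (measurableSet_phase_eq _)) (h1.min h2)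
    (Measurable.ite (measurable_fst (measurableSet_phase_eq _)) h1 measurable_const)

theorem loanModel_flow (k : Phase) (y t : ℝ) :
    (loanModel c ρ b lam f φ).flow k y t = if k = Phase.active then φ y t else y := by
  cases k <;> simp [loanModel]

theorem loanModel_move_active (y t : ℝ) :
    (loanModel c ρ b lam f φ).move (Phase.active, y) t = (Phase.active, φ y t) := rfl

theorem loanModel_move_of_ne {k : Phase} (hk : k ≠ Phase.active) (y t : ℝ) :
    (loanModel c ρ b lam f φ).move (k, y) t = (k, y) := by
  simp [PDMPData.move, loanModel_flow, hk]

theorem measurableSet_stateSpace_loanModel :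
    MeasurableSet (loanModel c ρ b lam f φ).stateSpace := by
  have : (loanModel c ρ b lam f φ).stateSpace =
      ⋃ k : Phase, {z | z.1 = k} ∩ (Prod.snd ⁻¹' phaseDom c ρ b k) := by
    ext ⟨k, y⟩
    simp [PDMPData.stateSpace, loanModel]
  rw [this]
  exact MeasurableSet.iUnion fun k => (measurableSet_phase_eq k).inter
    (measurable_snd (measurableSet_phaseDom k))

theorem loanModel_tStar_of_ne {k : Phase} (hk : k ≠ Phase.active) (y : ℝ) :
    (loanModel c ρ b lam f φ).tStar (k, y) = ⊤ := by
  simp only [PDMPData.tStar, iInf_eq_top, ENNReal.ofReal_ne_top, imp_false]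
  rintro t ⟨-, hfr, η, hη, hint⟩
  simp only [loanModel_flow, hk, if_false] at hfr hint
  exact hfr.2 (hint (η / 2) ⟨by linarith, by linarith⟩)

/-- The active boundary of the model in terms of the trajectories: the barrier is hit at the active
boundary if and only if it is reached. -/
def ReachesBarrierActively (c ρ b : ℝ) (φ : ℝ → ℝ → ℝ) : Prop :=
  (∃ y ∈ Ioo (-(c / ρ)) b, ∃ t, 0 < t ∧ φ y t = b) →
    ∃ η : ℝ, 0 < η ∧ ∀ t ∈ Ioo (0 : ℝ) η, φ b (-t) ∈ Ioo (-(c / ρ)) b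

theorem lt_tStar_active_iff (hφ : IsUpwardFlow φ) (hcrit : -(c / ρ) < b)
    (hact : ReachesBarrierActively c ρ b φ)
    {y : ℝ} (hy : y ∈ Ioo (-(c / ρ)) b) {t : ℝ} (ht : 0 ≤ t) :
    ENNReal.ofReal t < (loanModel c ρ b lam f φ).tStar (Phase.active, y) ↔ φ y t < b := by
  constructor
  · intro h
    by_contra! hb
    obtain ⟨s, hs, hsb⟩ := intermediate_value_Icc ht (hφ.continuous y).continuousOn
      (show b ∈ Icc (φ y 0) (φ y t) by rw [hφ.zero]; exact ⟨hy.2.le, hb⟩)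
    have hs0 : 0 < s := by
      refine hs.1.lt_of_ne fun h0 => ?_
      rw [← h0, hφ.zero] at hsb
      exact hy.2.ne hsb
    have hmem : b ∈ (loanModel c ρ b lam f φ).activeBoundary Phase.active := by
      obtain ⟨η, hη, h⟩ := hact ⟨y, hy, s, hs0, hsb⟩
      refine ⟨?_, η, hη, ?_⟩
      · simp [loanModel, phaseDom, frontier_Ioo hcrit]
      · simpa [loanModel, phaseDom] using h
    have hle : (loanModel c ρ b lam f φ).tStar (Phase.active, y) ≤ ENNReal.ofReal s :=
      iInf₂_le s ⟨hs0, by simpa [loanModel_flow, hsb] using hmem⟩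
    exact absurd (h.trans_le (hle.trans (ENNReal.ofReal_le_ofReal hs.2))) (lt_irrefl _)
  · intro h
    refine ((hφ.lt_hitTime_iff ht).2 h).trans_le (le_iInf₂ ?_)
    rintro s ⟨hs0, hs, -⟩
    have hdom : (loanModel c ρ b lam f φ).dom (Phase.active, y).1 = Ioo (-(c / ρ)) b := rfl
    rw [hdom, frontier_Ioo hcrit] at hs
    rw [hφ.hitTime_le_iff hs0.le]
    have h1 : φ y s = -(c / ρ) ∨ φ y s = b := hs
    rcases h1 with h1 | h1
    · have := hφ.le_apply y hs0.le
      linarith [hy.1]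
    · exact h1.ge

theorem loanModel_survival_active (hφ : IsUpwardFlow φ) (hcrit : -(c / ρ) < b)
    (hact : ReachesBarrierActively c ρ b φ)
    {y : ℝ} (hy : y ∈ Ioo (-(c / ρ)) b) {t : ℝ} (ht : 0 ≤ t) :
    (loanModel c ρ b lam f φ).survival (Phase.active, y) t =
      if φ y t < b then Real.exp (-lam * t) else 0 := by
  simp only [PDMPData.survival, lt_tStar_active_iff hφ hcrit hact hy ht]
  simp [loanModel, mul_comm]

theorem loanModel_survival_barrier (y t : ℝ) :
    (loanModel c ρ b lam f φ).survival (Phase.barrier, y) t = Real.exp (-lam * t) := by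
  simp [PDMPData.survival, loanModel_tStar_of_ne]
  simp [loanModel, mul_comm]

theorem loanModel_survival_ruin {k : Phase} (hk : k ≠ Phase.active) (hk' : k ≠ Phase.barrier)
    (y t : ℝ) : (loanModel c ρ b lam f φ).survival (k, y) t = 1 := by
  simp only [PDMPData.survival, loanModel_tStar_of_ne hk, ENNReal.ofReal_lt_top, if_true]
  cases k <;> simp_all [loanModel]

theorem loanModel_isSampledBy (hlam : 0 < lam) (hf : IsClaimDensity f)
    (hφ : IsUpwardFlow φ) (hcrit : -(c / ρ) < b) (hact : ReachesBarrierActively c ρ b φ) :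
    (loanModel c ρ b lam f φ).IsSampledBy (exponentialClock lam) (waitingTime b φ) where
  measurable_move := by
    have h1 : Measurable fun p : (Phase × ℝ) × ℝ => φ p.1.2 p.2 :=
      hφ.measurable.comp ((measurable_snd.comp measurable_fst).prodMk measurable_snd)
    have : (fun p : (Phase × ℝ) × ℝ => (loanModel c ρ b lam f φ).move p.1 p.2) =
        fun p => (p.1.1, if p.1.1 = Phase.active then φ p.1.2 p.2 else p.1.2) := by
      ext p <;> simp [PDMPData.move, loanModel_flow]
    rw [this]
    exact (measurable_fst.comp measurable_fst).prodMk (Measurable.ite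
      (measurable_fst (measurableSet_phase_eq _)) h1 (measurable_snd.comp measurable_fst))
  measurable_jump := measurable_claimJump hf
  isFiniteMeasure_jump := isFiniteMeasure_claimJump hf
  measurableSet_stateSpace := measurableSet_stateSpace_loanModel
  jump_compl := fun z => claimJump_compl φ lam z measurableSet_stateSpace_loanModel
  measurable_w := measurable_waitingTime hφ
  wait_law := by
    have := isProbabilityMeasure_exponentialClock hlam
    have hIoi : ∀ t : ℝ, 0 ≤ t → {s : ℝ | ENNReal.ofReal t < ENNReal.ofReal s} = Ioi t := by
      intro t ht
      ext s
      simp [ENNReal.ofReal_lt_ofReal_iff_of_nonneg ht]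
    rintro ⟨k, y⟩ hz t ht
    have hz' : y ∈ phaseDom c ρ b k := hz
    cases k
    · rw [loanModel_survival_active hφ hcrit hact hz' ht]
      simp only [waitingTime, if_true, lt_min_iff, hφ.lt_hitTime_iff ht]
      split_ifs with h
      · simp only [h, and_true]
        rw [hIoi t ht, exponentialClock_Ioi hlam ht]
      · simp [h]
    · rw [loanModel_survival_ruin (by simp) (by simp)]
      simp [waitingTime]
    · rw [loanModel_survival_ruin (by simp) (by simp)]
      simp [waitingTime]
    · rw [loanModel_survival_barrier]
      simp only [waitingTime, reduceCtorEq, if_false, if_true]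
      rw [hIoi t ht, exponentialClock_Ioi hlam ht]

end Model

/-! ### The value function as a fixed point -/

/-- One step of the value iteration for the surplus process which is stopped at the barrier, with
the reward rate `r` as a function of the surplus. -/
noncomputable def valueStep (c ρ b lam δ : ℝ) (f : ℝ → ℝ) (φ : ℝ → ℝ → ℝ) (r : ℝ → ℝ)
    (u : ℝ → ℝ≥0∞) (y : ℝ) : ℝ≥0∞ :=
  if y ≤ -(c / ρ) then 0 else ∫⁻ t in Ici (0 : ℝ), ENNReal.ofReal (Real.exp (-(lam + δ) * t)) *
    (ENNReal.ofReal (r (φ y t)) + ENNReal.ofReal lam * afterClaim f u (min (φ y t) b))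

/-- The limit of the value iteration. -/
noncomputable def valueFunction (c ρ b lam δ : ℝ) (f : ℝ → ℝ) (φ : ℝ → ℝ → ℝ) (r : ℝ → ℝ) (y : ℝ) :
    ℝ≥0∞ :=
  ⨆ n : ℕ, (valueStep c ρ b lam δ f φ r)^[n] (fun _ => 0) y

theorem afterClaim_mono (f : ℝ → ℝ) {u v : ℝ → ℝ≥0∞} (h : ∀ y, u y ≤ v y) (z : ℝ) :
    afterClaim f u z ≤ afterClaim f v z :=
  lintegral_mono fun _ => h _

section Value

variable {c ρ b lam δ : ℝ} {f : ℝ → ℝ} {φ : ℝ → ℝ → ℝ} {r : ℝ → ℝ}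

theorem valueStep_mono {u v : ℝ → ℝ≥0∞} (h : ∀ y, u y ≤ v y) (y : ℝ) :
    valueStep c ρ b lam δ f φ r u y ≤ valueStep c ρ b lam δ f φ r v y := by
  unfold valueStep
  split_ifs
  · exact le_rfl
  · gcongr
    exact afterClaim_mono f h _

theorem measurable_valueStep_integrand (hf : IsClaimDensity f) (hφ : IsUpwardFlow φ)
    (hr : Measurable r) {u : ℝ → ℝ≥0∞} (hu : Measurable u) :
    Measurable fun p : ℝ × ℝ => ENNReal.ofReal (Real.exp (-(lam + δ) * p.2)) *
      (ENNReal.ofReal (r (φ p.1 p.2)) + ENNReal.ofReal lam *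
        afterClaim f u (min (φ p.1 p.2) b)) := by
  have h1 := hφ.measurable
  have h2 := measurable_afterClaim hf hu
  have h3 : Measurable fun p : ℝ × ℝ => afterClaim f u (min (φ p.1 p.2) b) :=
    h2.comp (h1.min measurable_const)
  have h4 : Measurable fun p : ℝ × ℝ => r (φ p.1 p.2) := hr.comp h1
  fun_prop

theorem measurable_valueStep (hf : IsClaimDensity f) (hφ : IsUpwardFlow φ)
    (hr : Measurable r) {u : ℝ → ℝ≥0∞} (hu : Measurable u) :
    Measurable (valueStep c ρ b lam δ f φ r u) :=
  Measurable.ite measurableSet_Iic measurable_const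
    (measurable_valueStep_integrand hf hφ hr hu).lintegral_prod_right'

theorem afterClaim_le (hf : IsClaimDensity f) {u : ℝ → ℝ≥0∞} {M : ℝ≥0∞} (hu : ∀ y, u y ≤ M)
    (z : ℝ) : afterClaim f u z ≤ M := by
  have := isProbabilityMeasure_claimLaw hf
  calc afterClaim f u z ≤ ∫⁻ _, M ∂(claimLaw f) := lintegral_mono fun _ => hu _
    _ = M := by simp

theorem valueStep_le (hc : 0 < c) (hlam : 0 < lam) (hδ : 0 < δ) (hf : IsClaimDensity f)
    (hrc : ∀ y, r y ≤ c) {u : ℝ → ℝ≥0∞} (hu : ∀ y, u y ≤ ENNReal.ofReal (c / δ)) (y : ℝ) :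
    valueStep c ρ b lam δ f φ r u y ≤ ENNReal.ofReal (c / δ) := by
  unfold valueStep
  split_ifs
  · exact zero_le
  have hpos : 0 < lam + δ := by linarith
  calc _ ≤ ∫⁻ t in Ici (0 : ℝ), ENNReal.ofReal (Real.exp (-(lam + δ) * t)) *
        ENNReal.ofReal (c + lam * (c / δ)) := by
        refine lintegral_mono fun t => mul_le_mul' le_rfl ?_
        rw [ENNReal.ofReal_add hc.le (by positivity), ENNReal.ofReal_mul hlam.le]
        gcongr
        · exact hrc _
        · exact afterClaim_le hf hu _
    _ = ENNReal.ofReal (c / δ) := by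
        rw [lintegral_mul_const _ (by fun_prop), setLIntegral_exp_Ici hpos, mul_zero, Real.exp_zero,
          ← ENNReal.ofReal_mul (by positivity)]
        congr 1
        field_simp
        ring

theorem valueStep_iSup (hf : IsClaimDensity f) (hφ : IsUpwardFlow φ)
    (hr : Measurable r) {u : ℕ → ℝ → ℝ≥0∞} (hu : ∀ n, Measurable (u n))
    (hmono : ∀ y, Monotone fun n => u n y) (y : ℝ) :
    valueStep c ρ b lam δ f φ r (fun z => ⨆ n, u n z) y =
      ⨆ n, valueStep c ρ b lam δ f φ r (u n) y := by
  have hK : ∀ z, afterClaim f (fun z => ⨆ n, u n z) z = ⨆ n, afterClaim f (u n) z := by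
    intro z
    exact lintegral_iSup (fun n => (hu n).comp (measurable_const.sub measurable_id))
      fun m n hmn y => hmono _ hmn
  unfold valueStep
  by_cases hy : y ≤ -(c / ρ)
  · simp [hy]
  simp only [hy, if_false, hK]
  rw [← lintegral_iSup]
  · refine lintegral_congr fun t => ?_
    rw [ENNReal.mul_iSup, ENNReal.add_iSup, ENNReal.mul_iSup]
  · exact fun n => (measurable_valueStep_integrand hf hφ hr (hu n)).comp measurable_prodMk_left
  · intro m n hmn t
    have := afterClaim_mono f (fun z => hmono z hmn) (min (φ y t) b)
    dsimp only
    gcongr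

theorem measurable_valueStep_iterate (hf : IsClaimDensity f) (hφ : IsUpwardFlow φ)
    (hr : Measurable r) (n : ℕ) :
    Measurable ((valueStep c ρ b lam δ f φ r)^[n] fun _ => 0) := by
  induction n with
  | zero => exact measurable_const
  | succ n ih =>
    rw [Function.iterate_succ_apply']
    exact measurable_valueStep hf hφ hr ih

theorem monotone_valueStep_iterate (y : ℝ) :
    Monotone fun n => (valueStep c ρ b lam δ f φ r)^[n] (fun _ => 0) y := by
  refine monotone_nat_of_le_succ fun n => ?_
  induction n generalizing y with
  | zero => exact zero_le
  | succ n ih =>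
    rw [Function.iterate_succ_apply', Function.iterate_succ_apply']
    exact valueStep_mono ih y

theorem measurable_valueFunction (hf : IsClaimDensity f) (hφ : IsUpwardFlow φ)
    (hr : Measurable r) : Measurable (valueFunction c ρ b lam δ f φ r) :=
  Measurable.iSup fun n => measurable_valueStep_iterate hf hφ hr n

theorem valueStep_valueFunction (hf : IsClaimDensity f) (hφ : IsUpwardFlow φ)
    (hr : Measurable r) (y : ℝ) :
    valueStep c ρ b lam δ f φ r (valueFunction c ρ b lam δ f φ r) y =
      valueFunction c ρ b lam δ f φ r y := by
  have h := valueStep_iSup (c := c) (ρ := ρ) (b := b) (lam := lam) (δ := δ) hf hφ hr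
    (measurable_valueStep_iterate (c := c) (ρ := ρ) (b := b) (lam := lam) (δ := δ) hf hφ hr)
    monotone_valueStep_iterate y
  unfold valueFunction
  rw [h]
  refine (iSup_congr fun n => ?_).trans ((monotone_valueStep_iterate y).iSup_nat_add 1)
  rw [Function.iterate_succ_apply']

theorem valueFunction_le (hc : 0 < c) (hlam : 0 < lam) (hδ : 0 < δ) (hf : IsClaimDensity f)
    (hrc : ∀ y, r y ≤ c) (y : ℝ) :
    valueFunction c ρ b lam δ f φ r y ≤ ENNReal.ofReal (c / δ) := by
  refine iSup_le fun n => ?_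
  induction n generalizing y with
  | zero => exact zero_le
  | succ n ih =>
    rw [Function.iterate_succ_apply']
    exact valueStep_le hc hlam hδ hf hrc ih y

theorem valueFunction_eq_zero (hf : IsClaimDensity f) (hφ : IsUpwardFlow φ)
    (hr : Measurable r) {y : ℝ} (hy : y ≤ -(c / ρ)) :
    valueFunction c ρ b lam δ f φ r y = 0 := by
  rw [← valueStep_valueFunction hf hφ hr, valueStep, if_pos hy]

/-- The requirements on a dividend rate: it is bounded by the premium rate `c`, which is paid at
the barrier, and vanishes after ruin. -/
structure IsDividendRate (c : ℝ) (ell : Phase × ℝ → ℝ) : Prop where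
  measurable : Measurable ell
  nonneg : ∀ z, 0 ≤ ell z
  le : ∀ z, ell z ≤ c
  barrier : ∀ y, ell (Phase.barrier, y) = c
  ruined : ∀ y, ell (Phase.ruined, y) = 0
  critical : ∀ y, ell (Phase.critical, y) = 0

/-- The reward rate as a function of the surplus. -/
noncomputable def surplusReward (c b : ℝ) (ell : Phase × ℝ → ℝ) (z : ℝ) : ℝ :=
  if z < b then ell (Phase.active, z) else c

theorem IsDividendRate.measurable_surplusReward {ell : Phase × ℝ → ℝ} (h : IsDividendRate c ell) :
    Measurable (surplusReward c b ell) :=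
  Measurable.ite measurableSet_Iio (h.measurable.comp measurable_prodMk_left) measurable_const

theorem IsDividendRate.surplusReward_le {ell : Phase × ℝ → ℝ} (h : IsDividendRate c ell) (z : ℝ) :
    surplusReward c b ell z ≤ c := by
  unfold surplusReward
  split_ifs
  · exact h.le _
  · exact le_rfl

theorem measurableSet_cemetery : MeasurableSet (cemetery c ρ b) := by
  have : cemetery c ρ b = ({z | z.1 = Phase.ruined} ∩ Prod.snd ⁻¹' phaseDom c ρ b Phase.ruined) ∪
      ({z | z.1 = Phase.critical} ∩ Prod.snd ⁻¹' phaseDom c ρ b Phase.critical) := by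
    ext ⟨k, y⟩
    cases k <;> simp [cemetery]
  rw [this]
  exact ((measurableSet_phase_eq _).inter (measurable_snd (measurableSet_phaseDom _))).union
    ((measurableSet_phase_eq _).inter (measurable_snd (measurableSet_phaseDom _)))

/-- The value at the barrier. -/
theorem eq_of_valueStep_barrier (hcrit : -(c / ρ) < b) (hlam : 0 < lam) (hδ : 0 < δ)
    (hφ : IsUpwardFlow φ) {ell : Phase × ℝ → ℝ} {u : ℝ → ℝ≥0∞}
    (hfix : valueStep c ρ b lam δ f φ (surplusReward c b ell) u b = u b) :
    u b = ENNReal.ofReal (1 / (lam + δ)) *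
      (ENNReal.ofReal c + ENNReal.ofReal lam * afterClaim f u b) := by
  rw [← hfix, valueStep, if_neg (not_le.2 hcrit)]
  have h : ∀ t ∈ Ici (0 : ℝ), ENNReal.ofReal (Real.exp (-(lam + δ) * t)) *
      (ENNReal.ofReal (surplusReward c b ell (φ b t)) + ENNReal.ofReal lam *
        afterClaim f u (min (φ b t) b)) = ENNReal.ofReal (Real.exp (-(lam + δ) * t)) *
      (ENNReal.ofReal c + ENNReal.ofReal lam * afterClaim f u b) := by
    intro t ht
    have := hφ.le_apply b ht
    rw [surplusReward, if_neg (not_lt.2 this), min_eq_right this]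
  rw [setLIntegral_congr_fun measurableSet_Ici h, lintegral_mul_const _ (by fun_prop),
    setLIntegral_exp_Ici (by linarith), mul_zero, Real.exp_zero]

theorem one_step_equation (hc : 0 < c) (hρ : 0 < ρ) (hb : 0 < b) (hlam : 0 < lam) (hδ : 0 < δ)
    (hf : IsClaimDensity f) (hφ : IsUpwardFlow φ) (hact : ReachesBarrierActively c ρ b φ)
    {ell : Phase × ℝ → ℝ} (hell : IsDividendRate c ell) {u : ℝ → ℝ≥0∞} (hu : Measurable u)
    (hu0 : ∀ y, y ≤ -(c / ρ) → u y = 0)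
    (hfix : ∀ y, valueStep c ρ b lam δ f φ (surplusReward c b ell) u y = u y)
    (z : Phase × ℝ) (hz : z ∈ (loanModel c ρ b lam f φ).stateSpace) :
    u z.2 = ∫⁻ s, ((loanModel c ρ b lam f φ).runningReward δ ell z (waitingTime b φ z s) +
      discount δ (waitingTime b φ z s) * ∫⁻ y, u y.2 ∂((loanModel c ρ b lam f φ).jump
        ((loanModel c ρ b lam f φ).move z (waitingTime b φ z s).toReal)))
        ∂(exponentialClock lam) := by
  have hcρ : 0 < c / ρ := div_pos hc hρ
  have hcrit : -(c / ρ) < b := by linarith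
  have hD := loanModel_isSampledBy (ρ := ρ) hlam hf hφ hcrit hact
  have := isProbabilityMeasure_exponentialClock hlam
  have hwz : Measurable (waitingTime b φ z) := hD.measurable_w.comp measurable_prodMk_left
  have hJ : Measurable fun s => discount δ (waitingTime b φ z s) * ∫⁻ y, u y.2
      ∂((loanModel c ρ b lam f φ).jump
        ((loanModel c ρ b lam f φ).move z (waitingTime b φ z s).toReal)) :=
    ((measurable_discount δ).comp hwz).mul ((Measure.measurable_lintegral
      (hu.comp measurable_snd)).comp (hD.measurable_jump.comp (hD.measurable_move.comp
        (measurable_const.prodMk hwz.ennreal_toReal))))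
  have hub := eq_of_valueStep_barrier hcrit hlam hδ hφ (hfix b)
  rw [lintegral_add_right _ hJ, hD.lintegral_runningReward hell.measurable δ hz,
    lintegral_exponentialClock lam hJ]
  have hexp : ∀ t, ENNReal.ofReal (Real.exp (-(lam + δ) * t)) =
      ENNReal.ofReal (Real.exp (-δ * t)) * ENNReal.ofReal (Real.exp (-lam * t)) := fun t => by
    rw [← ENNReal.ofReal_mul (Real.exp_nonneg _), ← Real.exp_add]
    ring_nf
  have hexp' : ∀ t, ENNReal.ofReal (lam * Real.exp (-lam * t)) =
      ENNReal.ofReal lam * ENNReal.ofReal (Real.exp (-lam * t)) := fun t =>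
    ENNReal.ofReal_mul hlam.le
  have hexp'' : ∀ t x, ENNReal.ofReal (Real.exp (-δ * t) * x) =
      ENNReal.ofReal (Real.exp (-δ * t)) * ENNReal.ofReal x := fun t x =>
    ENNReal.ofReal_mul (Real.exp_nonneg _)
  have hjump : (loanModel c ρ b lam f φ).jump = claimJump c ρ b f := rfl
  obtain ⟨k, y⟩ := z
  have hz' : y ∈ phaseDom c ρ b k := hz
  by_cases hruin : k ≠ Phase.active ∧ k ≠ Phase.barrier
  · have hy : y ≤ -(c / ρ) := by
      cases k
      · simp at hruin
      · exact le_of_lt hz'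
      · exact le_of_eq hz'
      · simp at hruin
    have hw : ∀ s, waitingTime b φ (k, y) s = ⊤ := fun s => by simp [waitingTime, hruin]
    have hl : ∀ t, ell ((loanModel c ρ b lam f φ).move (k, y) t) = 0 := fun t => by
      rw [loanModel_move_of_ne hruin.1]
      cases k
      · simp at hruin
      · exact hell.ruined y
      · exact hell.critical y
      · simp at hruin
    simp [hw, hl, discount_top, hu0 y hy]
  rw [← lintegral_add_right _ (by fun_prop)]
  by_cases hk : k = Phase.barrier
  · subst hk
    have hyb : y = b := hz'
    subst hyb
    rw [← hfix, valueStep, if_neg (not_le.2 hcrit)]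
    refine setLIntegral_congr_fun measurableSet_Ici fun t ht => ?_
    have h1 := hφ.le_apply y ht
    have hw : waitingTime y φ (Phase.barrier, y) t = ENNReal.ofReal t := by simp [waitingTime]
    simp only [hw]
    rw [surplusReward, if_neg (not_lt.2 h1), min_eq_right h1, loanModel_survival_barrier,
      loanModel_move_of_ne (by simp), loanModel_move_of_ne (by simp), hjump,
      lintegral_claimJump_of_ne hc hρ hb hu (by simp) le_rfl, hell.barrier,
      discount_ofReal _ ht, hexp, hexp', hexp'']
    ring
  · have hka : k = Phase.active := by
      by_contra h
      exact hruin ⟨h, hk⟩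
    subst hka
    have hy : y ∈ Ioo (-(c / ρ)) b := hz'
    have hφy := hφ.measurable_right y
    have hS : MeasurableSet {t | φ y t < b} := measurableSet_lt hφy measurable_const
    rw [← hfix, valueStep, if_neg (not_le.2 hy.1), ← lintegral_inter_add_sdiff _ _ hS,
      ← lintegral_inter_add_sdiff _ (Ici (0 : ℝ)) hS]
    congr 1
    · refine setLIntegral_congr_fun (measurableSet_Ici.inter hS) fun t ht => ?_
      have ht0 : 0 ≤ t := ht.1
      have htb : φ y t < b := ht.2
      have hw : waitingTime b φ (Phase.active, y) t = ENNReal.ofReal t := by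
        simp only [waitingTime, if_true]
        exact min_eq_left ((hφ.lt_hitTime_iff ht0).2 htb).le
      simp only [hw, loanModel_move_active]
      rw [surplusReward, if_pos htb, min_eq_left htb.le,
        loanModel_survival_active hφ hcrit hact hy ht0, if_pos htb, hjump,
        ENNReal.toReal_ofReal ht0, lintegral_claimJump_of_ne hc hρ hb hu
          (by simpa using htb.ne) htb.le, discount_ofReal _ ht0, hexp, hexp', hexp'']
      ring
    · by_cases hhit : hitTime b φ y = ⊤
      · have hempty : Ici (0 : ℝ) \ {t | φ y t < b} = ∅ := by
          refine eq_empty_of_forall_notMem fun t ht => ht.2 ?_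
          refine (hφ.lt_hitTime_iff (mem_Ici.1 ht.1)).1 ?_
          rw [hhit]
          exact ENNReal.ofReal_lt_top
        simp [hempty]
      · set τ := (hitTime b φ y).toReal with hτ
        have hτ0 : 0 ≤ τ := ENNReal.toReal_nonneg
        have hτe : hitTime b φ y = ENNReal.ofReal τ := (ENNReal.ofReal_toReal hhit).symm
        have hset : Ici (0 : ℝ) \ {t | φ y t < b} = Ici τ := by
          ext t
          constructor
          · rintro ⟨ht, htb⟩
            exact ENNReal.toReal_le_of_le_ofReal ht ((hφ.hitTime_le_iff ht).2 (not_lt.1 htb))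
          · intro ht
            have ht0 := hτ0.trans ht
            refine ⟨ht0, not_lt.2 ((hφ.hitTime_le_iff ht0).1 ?_)⟩
            rw [hτe]
            exact ENNReal.ofReal_le_ofReal ht
        have hφτ : φ y τ = b := hφ.apply_hitTime hy.2 hhit
        rw [hset]
        have hL : ∀ t ∈ Ici τ, ENNReal.ofReal (Real.exp (-(lam + δ) * t)) *
            (ENNReal.ofReal (surplusReward c b ell (φ y t)) +
              ENNReal.ofReal lam * afterClaim f u (min (φ y t) b)) =
            ENNReal.ofReal (Real.exp (-(lam + δ) * t)) *
              (ENNReal.ofReal c + ENNReal.ofReal lam * afterClaim f u b) := by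
          intro t ht
          have h1 : b ≤ φ y t := hφτ ▸ hφ.monotone y ht
          rw [surplusReward, if_neg (not_lt.2 h1), min_eq_right h1]
        rw [setLIntegral_congr_fun measurableSet_Ici hL, lintegral_mul_const _ (by fun_prop),
          setLIntegral_exp_Ici (by linarith)]
        have hR : ∀ t ∈ Ici τ, ENNReal.ofReal (Real.exp (-δ * t) *
              ell ((loanModel c ρ b lam f φ).move (Phase.active, y) t)) *
              ENNReal.ofReal ((loanModel c ρ b lam f φ).survival (Phase.active, y) t) +
            ENNReal.ofReal (lam * Real.exp (-lam * t)) *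
              (discount δ (waitingTime b φ (Phase.active, y) t) *
              ∫⁻ y, u y.2 ∂((loanModel c ρ b lam f φ).jump ((loanModel c ρ b lam f φ).move
                (Phase.active, y) (waitingTime b φ (Phase.active, y) t).toReal))) =
            ENNReal.ofReal (lam * Real.exp (-lam * t)) *
              (ENNReal.ofReal (Real.exp (-δ * τ)) * u b) := by
          intro t ht
          have h1 : b ≤ φ y t := hφτ ▸ hφ.monotone y ht
          have hw : waitingTime b φ (Phase.active, y) t = ENNReal.ofReal τ := by
            simp only [waitingTime, if_true, hτe]
            exact min_eq_right (ENNReal.ofReal_le_ofReal ht)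
          rw [hw, loanModel_survival_active hφ hcrit hact hy (hτ0.trans ht),
            if_neg (not_lt.2 h1), ENNReal.ofReal_zero, mul_zero, zero_add,
            ENNReal.toReal_ofReal hτ0, loanModel_move_active, hφτ, hjump, claimJump_barrier_hit,
            lintegral_dirac, discount_ofReal _ hτ0]
        rw [setLIntegral_congr_fun measurableSet_Ici hR, lintegral_mul_const _ (by fun_prop),
          setLIntegral_exponential_density hlam, hub, div_eq_mul_one_div,
          ENNReal.ofReal_mul (Real.exp_nonneg _), hexp]
        ring

/-- The expected discounted dividends are given by the value function. -/
theorem expectedReward_eq_valueFunction (hc : 0 < c) (hρ : 0 < ρ) (hb : 0 < b) (hlam : 0 < lam)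
    (hδ : 0 < δ) (hf : IsClaimDensity f) (hφ : IsUpwardFlow φ)
    (hact : ReachesBarrierActively c ρ b φ) {ell : Phase × ℝ → ℝ} (hell : IsDividendRate c ell)
    {x : Phase × ℝ} (hx : x ∈ (loanModel c ρ b lam f φ).stateSpace)
    {Ω : Type*} [MeasurableSpace Ω] {P : Measure Ω} [IsProbabilityMeasure P]
    {X : ℝ → Ω → Phase × ℝ} (hX : (loanModel c ρ b lam f φ).IsPDMP P x X) :
    expectedReward P X δ ell (cemetery c ρ b) =
      (valueFunction c ρ b lam δ f φ (surplusReward c b ell) x.2).toReal := by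
  obtain ⟨T, Z, hX⟩ := hX
  have hcρ : 0 < c / ρ := div_pos hc hρ
  have := isProbabilityMeasure_exponentialClock hlam
  have hr := hell.measurable_surplusReward (b := b)
  have hu := measurable_valueFunction (c := c) (ρ := ρ) (b := b) (lam := lam) (δ := δ) hf hφ hr
  refine hX.expectedReward_eq
    (v := fun z => valueFunction c ρ b lam δ f φ (surplusReward c b ell) z.2)
    (loanModel_isSampledBy hlam hf hφ (by linarith) hact) hx hδ hell.measurable
    hell.nonneg measurableSet_cemetery ?_ ?_ ?_ (hu.comp measurable_snd) ENNReal.ofReal_ne_top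
    (fun z => valueFunction_le hc hlam hδ hf hell.surplusReward_le z.2)
    (one_step_equation hc hρ hb hlam hδ hf hφ hact hell hu
      (fun y => valueFunction_eq_zero hf hφ hr) (valueStep_valueFunction hf hφ hr))
  · rintro ⟨k, y⟩ ⟨-, h | h⟩ <;> simp only at h <;> subst h
    · exact hell.ruined y
    · exact hell.critical y
  · rintro ⟨k, y⟩ t
    cases k
    · simp [loanModel_move_active, cemetery]
    all_goals rw [loanModel_move_of_ne (by simp)]
  · rintro ⟨k, y⟩ ⟨-, h | h⟩ s <;> simp only at h <;> subst h <;> simp [waitingTime]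

end Value

/-! ### Regularity of the claim density -/

theorem exists_bound_of_continuousOn_of_tendsto {g : ℝ → ℝ} (hg : ContinuousOn g (Ici 0))
    (hlim : Tendsto g atTop (𝓝 0)) : ∃ B : ℝ, 0 ≤ B ∧ ∀ y, 0 ≤ y → |g y| ≤ B := by
  have h1 : ∀ᶠ y in atTop, |g y| < 1 := by
    have := hlim.abs
    rw [abs_zero] at this
    exact this.eventually (gt_mem_nhds one_pos)
  obtain ⟨N, hN⟩ := eventually_atTop.1 h1
  obtain ⟨B, hB⟩ := isCompact_Icc.exists_bound_of_continuousOn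
    (hg.mono (Icc_subset_Ici_self : Icc 0 N ⊆ Ici 0))
  refine ⟨max B 1, by positivity, fun y hy => ?_⟩
  rcases le_total N y with h | h
  · exact (hN y h).le.trans (le_max_right _ _)
  · exact (hB y ⟨hy, h⟩).trans (le_max_left _ _)

theorem IsClaimDensity.exists_bound {f : ℝ → ℝ} (hf : IsClaimDensity f) :
    ∃ B : ℝ, 0 ≤ B ∧ ∀ y, 0 ≤ y → f y ≤ B := by
  obtain ⟨B, hB0, hB⟩ := exists_bound_of_continuousOn_of_tendsto hf.contDiffOn.continuousOn
    (by simpa using hf.vanish 0 (by norm_num))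
  exact ⟨B, hB0, fun y hy => (le_abs_self _).trans (hB y hy)⟩

theorem IsClaimDensity.exists_lipschitz {f : ℝ → ℝ} (hf : IsClaimDensity f) :
    ∃ L : ℝ, 0 ≤ L ∧ ∀ y y', 0 ≤ y → 0 ≤ y' → f y ≤ f y' + L * |y - y'| := by
  have h1 : Tendsto (derivWithin f (Ici 0)) atTop (𝓝 0) := by
    have := hf.vanish 1 (by norm_num)
    rwa [iteratedDerivWithin_one] at this
  obtain ⟨L, hL0, hL⟩ := exists_bound_of_continuousOn_of_tendsto
    (hf.contDiffOn.continuousOn_derivWithin (uniqueDiffOn_Ici 0) (by norm_num)) h1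
  refine ⟨L, hL0, fun y y' hy hy' => ?_⟩
  have h2 := (convex_Ici (0 : ℝ)).norm_image_sub_le_of_norm_derivWithin_le
    (hf.contDiffOn.differentiableOn (by norm_num)) (fun x hx => hL x hx) hy' hy
  have := (le_abs_self _).trans h2
  rw [Real.norm_eq_abs] at this
  linarith

/-- The claim density, extended by `0`. -/
noncomputable def extendedDensity (f : ℝ → ℝ) (s : ℝ) : ℝ≥0∞ :=
  (Ici (0 : ℝ)).indicator (fun s => ENNReal.ofReal (f s)) s

theorem measurable_extendedDensity {f : ℝ → ℝ} (hf : IsClaimDensity f) :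
    Measurable (extendedDensity f) := by
  have h : extendedDensity f = (Ici (0 : ℝ)).piecewise (fun s => ENNReal.ofReal (f s)) 0 := by
    ext s
    simp [extendedDensity, indicator, piecewise]
  rw [h]
  exact (ENNReal.continuous_ofReal.comp_continuousOn hf.contDiffOn.continuousOn).measurable_piecewise
    continuousOn_const measurableSet_Ici

theorem afterClaim_eq {f : ℝ → ℝ} (hf : IsClaimDensity f) {u : ℝ → ℝ≥0∞} (hu : Measurable u)
    (z : ℝ) : afterClaim f u z = ∫⁻ s, u s * extendedDensity f (z - s) := by
  have h1 : Measurable fun y => u (z - y) := hu.comp (measurable_const.sub measurable_id)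
  rw [afterClaim, claimLaw, lintegral_withDensity_eq_lintegral_mul₀
    (measurable_ofReal_claimDensity hf) h1.aemeasurable,
    ← lintegral_sub_left_eq_self (fun s => u s * extendedDensity f (z - s)) z,
    ← lintegral_indicator measurableSet_Ici]
  refine lintegral_congr fun y => ?_
  rw [sub_sub_cancel, extendedDensity]
  by_cases hy : y ∈ Ici (0 : ℝ)
  · simp [hy, mul_comm]
  · simp [hy]

theorem afterClaim_le_add {f : ℝ → ℝ} (hf : IsClaimDensity f) {B L : ℝ} (hB0 : 0 ≤ B) (hL0 : 0 ≤ L)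
    (hB : ∀ y, 0 ≤ y → f y ≤ B)
    (hL : ∀ y y', 0 ≤ y → 0 ≤ y' → f y ≤ f y' + L * |y - y'|)
    {u : ℝ → ℝ≥0∞} (hu : Measurable u) {m a b : ℝ} (hm : 0 ≤ m) (hum : ∀ y, u y ≤ ENNReal.ofReal m)
    (hua : ∀ y, y ≤ a → u y = 0) (hab : a ≤ b) {z z' : ℝ} (hz : z ≤ b) :
    afterClaim f u z ≤ afterClaim f u z' +
      ENNReal.ofReal (m * (L * (b - a) + B) * |z - z'|) := by
  have hF := measurable_extendedDensity hf
  have hpt : ∀ s, u s * extendedDensity f (z - s) ≤ u s * extendedDensity f (z' - s) +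
      ((Ioc a b).indicator (fun _ => ENNReal.ofReal (m * (L * |z - z'|))) s +
        (Ioc z' z).indicator (fun _ => ENNReal.ofReal (m * B)) s) := by
    intro s
    by_cases hsa : s ≤ a
    · simp [hua s hsa]
    by_cases hsz : z < s
    · have : z - s ∉ Ici (0 : ℝ) := by simpa using hsz
      rw [extendedDensity, indicator_of_notMem this, mul_zero]
      exact zero_le
    have h0 : z - s ∈ Ici (0 : ℝ) := by simpa using hsz
    rw [extendedDensity, indicator_of_mem h0]
    by_cases hsz' : z' < s
    · have hmem : s ∈ Ioc z' z := ⟨hsz', not_lt.1 hsz⟩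
      rw [indicator_of_mem hmem, ENNReal.ofReal_mul (q := B) hm]
      exact (mul_le_mul' (hum s) (ENNReal.ofReal_le_ofReal (hB _ h0))).trans
        (le_add_left le_add_self)
    · have h0' : z' - s ∈ Ici (0 : ℝ) := by simpa using hsz'
      have hmem : s ∈ Ioc a b := ⟨not_le.1 hsa, (not_lt.1 hsz).trans hz⟩
      rw [extendedDensity, indicator_of_mem h0', indicator_of_mem hmem, ENNReal.ofReal_mul hm]
      have h1 := hL (z - s) (z' - s) h0 h0'
      rw [sub_sub_sub_cancel_right] at h1
      calc u s * ENNReal.ofReal (f (z - s))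
          ≤ u s * (ENNReal.ofReal (f (z' - s)) + ENNReal.ofReal (L * |z - z'|)) := by
            rw [← ENNReal.ofReal_add (hf.nonneg _ h0') (by positivity)]
            gcongr
        _ ≤ u s * ENNReal.ofReal (f (z' - s)) +
            ENNReal.ofReal m * ENNReal.ofReal (L * |z - z'|) := by
            rw [mul_add]
            gcongr
            exact hum s
        _ ≤ _ := by
            gcongr
            exact le_self_add
  rw [afterClaim_eq hf hu, afterClaim_eq hf hu]
  refine (lintegral_mono hpt).trans ?_
  have hF' : Measurable fun s => u s * extendedDensity f (z' - s) :=
    hu.mul (hF.comp (measurable_const.sub measurable_id))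
  rw [lintegral_add_left hF', lintegral_add_left (measurable_const.indicator measurableSet_Ioc),
    lintegral_indicator_const measurableSet_Ioc, lintegral_indicator_const measurableSet_Ioc,
    Real.volume_Ioc, Real.volume_Ioc, ← ENNReal.ofReal_mul (by positivity),
    ← ENNReal.ofReal_mul (by positivity)]
  gcongr
  have h1 : ENNReal.ofReal (m * B * (z - z')) ≤ ENNReal.ofReal (m * B * |z - z'|) :=
    ENNReal.ofReal_le_ofReal (mul_le_mul_of_nonneg_left (le_abs_self _) (by positivity))
  refine (add_le_add_right h1 _).trans ?_
  have hba : 0 ≤ b - a := by linarith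
  rw [← ENNReal.ofReal_add (by positivity) (by positivity)]
  exact ENNReal.ofReal_le_ofReal (le_of_eq (by ring))

/-! ### Perturbation of the value iteration -/

section Perturbation

variable {c ρ b lam δ : ℝ} {f : ℝ → ℝ} {φ φ' : ℝ → ℝ → ℝ} {r r' : ℝ → ℝ}

theorem valueStep_le_valueStep_add (hlam : 0 < lam) (hδ : 0 < δ) (hf : IsClaimDensity f)
    (hφ : IsUpwardFlow φ) (hφ' : IsUpwardFlow φ')
    (hr : Measurable r) (hr' : Measurable r') {u : ℝ → ℝ≥0∞} (hu : Measurable u)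
    {κ d e : ℝ} (hκ : 0 ≤ κ) (hd : 0 ≤ d) (he : 0 ≤ e)
    (hlip : ∀ z z', z ≤ b → z' ≤ b → afterClaim f u z ≤ afterClaim f u z' +
      ENNReal.ofReal (κ * |z - z'|)) {y : ℝ}
    (hdist : ∀ t, 0 ≤ t → |min (φ y t) b - min (φ' y t) b| ≤ d)
    (hrew : ∫⁻ t in Ici (0 : ℝ), ENNReal.ofReal (r (φ y t) - r' (φ' y t)) ≤ ENNReal.ofReal e) :
    valueStep c ρ b lam δ f φ r u y ≤ valueStep c ρ b lam δ f φ' r' u y +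
      ENNReal.ofReal (e + lam * (κ * d) / (lam + δ)) := by
  unfold valueStep
  split_ifs
  · exact zero_le
  have hpos : 0 < lam + δ := by linarith
  have hpt : ∀ t ∈ Ici (0 : ℝ), ENNReal.ofReal (Real.exp (-(lam + δ) * t)) *
      (ENNReal.ofReal (r (φ y t)) + ENNReal.ofReal lam * afterClaim f u (min (φ y t) b)) ≤
      ENNReal.ofReal (Real.exp (-(lam + δ) * t)) *
      (ENNReal.ofReal (r' (φ' y t)) + ENNReal.ofReal lam * afterClaim f u (min (φ' y t) b)) +
      (ENNReal.ofReal (r (φ y t) - r' (φ' y t)) +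
        ENNReal.ofReal (Real.exp (-(lam + δ) * t)) * ENNReal.ofReal (lam * (κ * d))) := by
    intro t ht
    have ht0 : 0 ≤ t := ht
    have h1 : ENNReal.ofReal (r (φ y t)) ≤
        ENNReal.ofReal (r' (φ' y t)) + ENNReal.ofReal (r (φ y t) - r' (φ' y t)) := by
      refine le_trans (ENNReal.ofReal_le_ofReal (by linarith)) ENNReal.ofReal_add_le
    have h2 : afterClaim f u (min (φ y t) b) ≤ afterClaim f u (min (φ' y t) b) +
        ENNReal.ofReal (κ * d) :=
      (hlip _ _ (min_le_right _ _) (min_le_right _ _)).trans (by gcongr; exact hdist t ht0)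
    have h3 : ENNReal.ofReal (Real.exp (-(lam + δ) * t)) ≤ 1 := by
      rw [← ENNReal.ofReal_one]
      exact ENNReal.ofReal_le_ofReal (Real.exp_le_one_iff.2 (by nlinarith))
    calc _ ≤ ENNReal.ofReal (Real.exp (-(lam + δ) * t)) *
          ((ENNReal.ofReal (r' (φ' y t)) + ENNReal.ofReal (r (φ y t) - r' (φ' y t))) +
            ENNReal.ofReal lam * (afterClaim f u (min (φ' y t) b) + ENNReal.ofReal (κ * d))) := by
          gcongr
      _ = ENNReal.ofReal (Real.exp (-(lam + δ) * t)) * (ENNReal.ofReal (r' (φ' y t)) +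
            ENNReal.ofReal lam * afterClaim f u (min (φ' y t) b)) +
          (ENNReal.ofReal (Real.exp (-(lam + δ) * t)) * ENNReal.ofReal (r (φ y t) - r' (φ' y t)) +
          ENNReal.ofReal (Real.exp (-(lam + δ) * t)) * ENNReal.ofReal (lam * (κ * d))) := by
          rw [ENNReal.ofReal_mul hlam.le]
          ring
      _ ≤ _ := by
          gcongr
          exact (mul_le_mul' h3 le_rfl).trans (one_mul _).le
  refine (setLIntegral_mono' measurableSet_Ici hpt).trans ?_
  have hm1 := (measurable_valueStep_integrand (b := b) (lam := lam) (δ := δ) hf hφ' hr' hu).comp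
    (measurable_prodMk_left (x := y))
  have hm2 : Measurable fun t => ENNReal.ofReal (r (φ y t) - r' (φ' y t)) :=
    ((hr.comp (hφ.measurable_right y)).sub (hr'.comp (hφ'.measurable_right y))).ennreal_ofReal
  have hm1' : Measurable fun t => ENNReal.ofReal (Real.exp (-(lam + δ) * t)) *
      (ENNReal.ofReal (r' (φ' y t)) +
        ENNReal.ofReal lam * afterClaim f u (min (φ' y t) b)) := hm1
  rw [lintegral_add_left hm1', lintegral_add_left hm2, lintegral_mul_const _ (by fun_prop),
    setLIntegral_exp_Ici hpos, mul_zero, Real.exp_zero, ENNReal.ofReal_add he (by positivity),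
    ← ENNReal.ofReal_mul (by positivity), one_div_mul_eq_div]
  gcongr

theorem valueStep_add_const_le (hlam : 0 < lam) (hδ : 0 < δ) (hf : IsClaimDensity f)
    (hφ : IsUpwardFlow φ) (hr : Measurable r) {u : ℝ → ℝ≥0∞} (hu : Measurable u) (C : ℝ≥0∞)
    (y : ℝ) :
    valueStep c ρ b lam δ f φ r (fun z => u z + C) y ≤
      valueStep c ρ b lam δ f φ r u y + ENNReal.ofReal (lam / (lam + δ)) * C := by
  have := isProbabilityMeasure_claimLaw hf
  have hK : ∀ z, afterClaim f (fun z => u z + C) z = afterClaim f u z + C := by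
    intro z
    unfold afterClaim
    rw [lintegral_add_right _ measurable_const]
    simp
  have hpos : 0 < lam + δ := by linarith
  unfold valueStep
  split_ifs
  · exact zero_le
  have h1 : Measurable fun t => ENNReal.ofReal (Real.exp (-(lam + δ) * t)) *
      (ENNReal.ofReal (r (φ y t)) + ENNReal.ofReal lam * afterClaim f u (min (φ y t) b)) :=
    (measurable_valueStep_integrand (b := b) (lam := lam) (δ := δ) hf hφ hr hu).comp
      (measurable_prodMk_left (x := y))
  simp only [hK]
  have h2 : ∀ t, ENNReal.ofReal (Real.exp (-(lam + δ) * t)) * (ENNReal.ofReal (r (φ y t)) +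
      ENNReal.ofReal lam * (afterClaim f u (min (φ y t) b) + C)) =
      ENNReal.ofReal (Real.exp (-(lam + δ) * t)) * (ENNReal.ofReal (r (φ y t)) +
        ENNReal.ofReal lam * afterClaim f u (min (φ y t) b)) +
      ENNReal.ofReal (Real.exp (-(lam + δ) * t)) * (ENNReal.ofReal lam * C) := fun t => by ring
  simp only [h2]
  rw [lintegral_add_left h1, lintegral_mul_const _ (by fun_prop), setLIntegral_exp_Ici hpos,
    mul_zero, Real.exp_zero, ← mul_assoc, ← ENNReal.ofReal_mul (by positivity),
    one_div_mul_eq_div]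

/-- If one step of the value iteration changes by at most `a`, then the value function changes by
at most `a * (lam + δ) / δ`. -/
theorem valueFunction_le_add (hc : 0 < c) (hlam : 0 < lam) (hδ : 0 < δ) (hf : IsClaimDensity f)
    (hφ : IsUpwardFlow φ) (hφ' : IsUpwardFlow φ')
    (hr : Measurable r) (hr' : Measurable r') (hrc' : ∀ y, r' y ≤ c) {a : ℝ} (ha : 0 ≤ a)
    (h : ∀ u : ℝ → ℝ≥0∞, Measurable u → (∀ y, u y ≤ ENNReal.ofReal (c / δ)) →
      (∀ y, y ≤ -(c / ρ) → u y = 0) → ∀ y, valueStep c ρ b lam δ f φ r u y ≤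
        valueStep c ρ b lam δ f φ' r' u y + ENNReal.ofReal a) (y : ℝ) :
    valueFunction c ρ b lam δ f φ r y ≤ valueFunction c ρ b lam δ f φ' r' y +
      ENNReal.ofReal (a * (lam + δ) / δ) := by
  set V := valueFunction c ρ b lam δ f φ' r' with hV
  have hVm : Measurable V := measurable_valueFunction hf hφ' hr'
  refine iSup_le fun n => ?_
  induction n generalizing y with
  | zero => exact zero_le
  | succ n ih =>
    rw [Function.iterate_succ_apply']
    calc _ ≤ valueStep c ρ b lam δ f φ r
          (fun z => V z + ENNReal.ofReal (a * (lam + δ) / δ)) y := valueStep_mono ih y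
      _ ≤ valueStep c ρ b lam δ f φ r V y +
          ENNReal.ofReal (lam / (lam + δ)) * ENNReal.ofReal (a * (lam + δ) / δ) :=
          valueStep_add_const_le hlam hδ hf hφ hr hVm _ y
      _ ≤ valueStep c ρ b lam δ f φ' r' V y + ENNReal.ofReal a +
          ENNReal.ofReal (lam / (lam + δ)) * ENNReal.ofReal (a * (lam + δ) / δ) := by
          gcongr
          exact h V hVm (valueFunction_le hc hlam hδ hf hrc')
            (fun z => valueFunction_eq_zero hf hφ' hr') y
      _ = V y + ENNReal.ofReal (a * (lam + δ) / δ) := by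
          rw [valueStep_valueFunction hf hφ' hr', add_assoc,
            ← ENNReal.ofReal_mul (by positivity), ← ENNReal.ofReal_add ha (by positivity)]
          congr 2
          field_simp
          ring

end Perturbation

/-! ### Heaviside functions -/

theorem IsHeaviside.exists_cubic_bound {h : ℝ → ℝ} (hh : IsHeaviside 2 h) {L : ℝ≥0}
    (hL : LipschitzWith L (iteratedDeriv 2 h)) {u : ℝ} (h0 : 0 ≤ u) :
    1 - h (1 - u) ≤ L * u ^ 3 := by
  have hcd : ContDiff ℝ 2 h := hh.contDiff
  have hcd1 : ContDiff ℝ 1 (deriv h) := by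
    have : ContDiff ℝ (1 + 1) h := by simpa [one_add_one_eq_two] using hcd
    exact ((contDiff_succ_iff_deriv (n := 1)).1 this).2.2
  have hd : Differentiable ℝ h := hcd.differentiable (by norm_num)
  have hd1 : Differentiable ℝ (deriv h) := hcd1.differentiable (by norm_num)
  have hc2 : Continuous (deriv (deriv h)) := hcd1.continuous_deriv (by norm_num)
  have hit : iteratedDeriv 2 h = deriv (deriv h) := by
    rw [iteratedDeriv_succ, iteratedDeriv_one]
  rw [hit] at hL
  have hext : ∀ (g : ℝ → ℝ) (a : ℝ), Continuous g → (∀ y, 1 < y → g y = a) → g 1 = a := by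
    intro g a hg hga
    have h1 : Tendsto g (𝓝[>] 1) (𝓝 (g 1)) := (hg.tendsto 1).mono_left nhdsWithin_le_nhds
    have h2 : Tendsto g (𝓝[>] 1) (𝓝 a) :=
      tendsto_const_nhds.congr' (by filter_upwards [self_mem_nhdsWithin] with y hy using (hga y hy).symm)
    exact tendsto_nhds_unique h1 h2
  have e0 : ∀ y, 1 < y → h y = 1 := hh.eq_one
  have e1 : ∀ y, 1 < y → deriv h y = 0 := by
    intro y hy
    have : h =ᶠ[𝓝 y] fun _ => 1 := by filter_upwards [lt_mem_nhds hy] with z hz using e0 z hz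
    rw [this.deriv_eq, deriv_const]
  have e2 : ∀ y, 1 < y → deriv (deriv h) y = 0 := by
    intro y hy
    have : deriv h =ᶠ[𝓝 y] fun _ => 0 := by filter_upwards [lt_mem_nhds hy] with z hz using e1 z hz
    rw [this.deriv_eq, deriv_const]
  have v0 := hext h 1 hd.continuous e0
  have v1 := hext (deriv h) 0 hd1.continuous e1
  have v2 := hext (deriv (deriv h)) 0 hc2 e2
  have b2 : ∀ x, x ≤ 1 → ‖deriv (deriv h) x‖ ≤ L * (1 - x) := by
    intro x hx
    have := hL.dist_le_mul x 1
    rwa [v2, dist_zero_right, dist_comm, Real.dist_eq, abs_of_nonneg (by linarith)] at this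
  have b1 : ∀ x, x ≤ 1 → ‖deriv h x‖ ≤ L * (1 - x) ^ 2 := by
    intro x hx
    have := (convex_Icc x 1).norm_image_sub_le_of_norm_deriv_le (f := deriv h) (C := L * (1 - x))
      (fun y _ => hd1 y) (fun y hy => (b2 y hy.2).trans
        (mul_le_mul_of_nonneg_left (by linarith [hy.1]) L.2)) ⟨hx, le_rfl⟩ ⟨le_rfl, hx⟩
    rw [v1, sub_zero, Real.norm_eq_abs (x - 1), abs_sub_comm, abs_of_nonneg (by linarith)] at this
    linarith
  have b0 := (convex_Icc (1 - u) 1).norm_image_sub_le_of_norm_deriv_le (f := h) (C := L * u ^ 2)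
      (fun y _ => hd y) (fun y hy => (b1 y hy.2).trans
        (mul_le_mul_of_nonneg_left (pow_le_pow_left₀ (by linarith [hy.2]) (by linarith [hy.1]) 2) L.2))
      ⟨le_rfl, by linarith⟩ ⟨by linarith, le_rfl⟩
  rw [v0, sub_sub_cancel, Real.norm_eq_abs u, abs_of_nonneg h0] at b0
  have := (le_abs_self _).trans b0
  linarith

/-! ### Comparison of the flows -/

section Flows

variable {c ρ b ε : ℝ} {φ φε : ℝ → ℝ → ℝ}

theorem smoothFlow_le_flow (hs : SmoothingScale c ρ b ε) (hφ : IsODEFlow (drift c ρ) φ)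
    (hφε : IsODEFlow (smoothDrift c ρ b ε) φε) (y : ℝ) {t : ℝ} (ht : 0 ≤ t) :
    φε y t ≤ φ y t :=
  le_of_subsolution_of_supersolution (lipschitzWith_drift hs.premium_pos hs.rate_pos)
    (hφε y).2 (hφ y).2 (fun _ _ => smoothDrift_le_drift hs _) (fun _ _ => le_rfl)
    (by rw [(hφε y).1, (hφ y).1]) ⟨ht, le_rfl⟩

theorem smoothFlow_le_barrier (hs : SmoothingScale c ρ b ε)
    (hφε : IsODEFlow (smoothDrift c ρ b ε) φε) {y : ℝ} (hy : y ≤ b) {t : ℝ} (ht : 0 ≤ t) :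
    φε y t ≤ b := by
  obtain ⟨κ, hκ⟩ := exists_lipschitzWith_smoothDrift hs
  exact le_of_subsolution_of_supersolution (z := fun _ => b) (z' := fun _ => 0) hκ (hφε y).2
    (fun s => hasDerivAt_const s b) (fun _ _ => le_rfl)
    (fun _ _ => (smoothDrift_eq_zero hs le_rfl).le) (by rw [(hφε y).1]; exact hy) ⟨ht, le_rfl⟩

theorem sub_smoothFlow_le (hs : SmoothingScale c ρ b ε) (hεc : ε ≤ c / ρ / 2)
    (hφ : IsODEFlow (drift c ρ) φ) (hφε : IsODEFlow (smoothDrift c ρ b ε) φε) {y : ℝ} {t : ℝ}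
    (ht : 0 ≤ t) :
    min (φ y t) b - φε y t ≤ (1 + 4 * ρ * b / c) * ε := by
  obtain ⟨hc, hρ, hε, hεb, hεc'⟩ := id hs
  have hb : 0 < b := by linarith
  have hD : 0 ≤ 4 * ρ * b / c * ε := by positivity
  have hmono := hφε.monotone (smoothDrift_nonneg hs) y
  have hlip := lipschitzWith_drift hc hρ
  rcases le_total (b - ε) (φε y t) with h1 | h1
  · have := min_le_right (φ y t) b
    linarith
  rcases le_total (φε y t) (-ε) with h2 | h2
  · have h3 : φ y t ≤ φε y t := le_of_subsolution_of_supersolution (a := 0) (b := t) hlip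
      (hφ y).2 (hφε y).2 (fun _ _ => le_rfl) (fun s hs' =>
        (smoothDrift_eq_drift hs ((hmono hs'.2.le).trans h2)).ge)
      (by rw [(hφε y).1, (hφ y).1]) ⟨ht, le_rfl⟩
    have := min_le_left (φ y t) b
    nlinarith
  obtain ⟨t₀, ht₀, h3, h4⟩ : ∃ t₀ ∈ Icc 0 t, -ε ≤ φε y t₀ ∧ φ y t₀ ≤ φε y t₀ := by
    rcases le_total (-ε) y with hy | hy
    · exact ⟨0, ⟨le_rfl, ht⟩, by rw [(hφε y).1]; exact hy, by rw [(hφε y).1, (hφ y).1]⟩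
    · obtain ⟨t₀, ht₀, h⟩ := intermediate_value_Icc ht (hφε.continuous y).continuousOn
        (show -ε ∈ Icc (φε y 0) (φε y t) by rw [(hφε y).1]; exact ⟨hy, h2⟩)
      refine ⟨t₀, ht₀, h.ge, le_of_subsolution_of_supersolution (a := 0) (b := t₀) hlip
        (hφ y).2 (hφε y).2 (fun _ _ => le_rfl) (fun s hs' =>
          (smoothDrift_eq_drift hs ((hmono hs'.2.le).trans h.le)).ge)
        (by rw [(hφε y).1, (hφ y).1]) ⟨ht₀.1, le_rfl⟩⟩
  have hlin : ∀ s, HasDerivAt (fun s => c * (s - t₀)) c s := fun s => by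
    simpa using ((hasDerivAt_id s).sub_const t₀).const_mul c
  have h5 : c * (t - t₀) ≤ (1 + 2 * ρ / c * ε) * (φε y t - φε y t₀) :=
    le_of_subsolution_of_supersolution (g := fun _ => c) (κ := 0) (a := t₀) (b := t)
      (u := fun s => c * (s - t₀)) (z := fun s => (1 + 2 * ρ / c * ε) * (φε y s - φε y t₀))
      (LipschitzWith.const c) hlin
      (fun s => (((hφε y).2 s).sub_const _).const_mul _) (fun _ _ => le_rfl)
      (fun s hs' => le_mul_smoothDrift hs hεc (h3.trans (hmono hs'.1)) ((hmono hs'.2.le).trans h1))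
      (by simp) ⟨ht₀.2, le_rfl⟩
  have h6 : φ y t - φ y t₀ ≤ c * (t - t₀) :=
    le_of_subsolution_of_supersolution (g := fun _ => c) (κ := 0) (a := t₀) (b := t)
      (u := fun s => φ y s - φ y t₀) (LipschitzWith.const c)
      (fun s => ((hφ y).2 s).sub_const _) hlin (fun _ _ => drift_le hc hρ _)
      (fun _ _ => le_rfl) (by simp) ⟨ht₀.2, le_rfl⟩
  have h7 : φε y t - φε y t₀ ≤ 2 * b := by linarith
  have h8 : 2 * ρ / c * ε * (φε y t - φε y t₀) ≤ 2 * ρ / c * ε * (2 * b) :=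
    mul_le_mul_of_nonneg_left h7 (by positivity)
  have h9 : 2 * ρ / c * ε * (2 * b) = 4 * ρ * b / c * ε := by ring
  have := min_le_left (φ y t) b
  linarith

theorem abs_min_sub_min_le (hs : SmoothingScale c ρ b ε) (hεc : ε ≤ c / ρ / 2)
    (hφ : IsODEFlow (drift c ρ) φ) (hφε : IsODEFlow (smoothDrift c ρ b ε) φε) (y : ℝ) {t : ℝ}
    (ht : 0 ≤ t) :
    |min (φε y t) b - min (φ y t) b| ≤ (1 + 4 * ρ * b / c) * ε := by
  obtain ⟨hc, hρ, hε, hεb, hεc'⟩ := id hs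
  have hb : 0 < b := by linarith
  have h1 := min_le_min_right b (smoothFlow_le_flow hs hφ hφε y ht)
  have h2 := sub_smoothFlow_le hs hεc hφ hφε (y := y) ht
  have h3 : 0 ≤ (1 + 4 * ρ * b / c) * ε := by positivity
  rw [abs_sub_comm, abs_of_nonneg (by linarith)]
  rcases le_total (φε y t) b with h | h
  · rwa [min_eq_left h]
  · rw [min_eq_right h]
    linarith [min_le_right (φ y t) b]

theorem reachesBarrierActively_flow (hc : 0 < c) (hρ : 0 < ρ) (hb : 0 < b)
    (hφ : IsODEFlow (drift c ρ) φ) : ReachesBarrierActively c ρ b φ := by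
  intro _
  have hcρ : 0 < c / ρ := div_pos hc hρ
  have h0 : φ b 0 = b := (hφ b).1
  have hslope := hasDerivAt_iff_tendsto_slope.1 ((hφ b).2 0)
  rw [h0, drift, if_pos hb] at hslope
  have h1 : ∀ᶠ s in 𝓝[<] (0 : ℝ), 0 < slope (φ b) 0 s :=
    (hslope.mono_left (nhdsWithin_mono 0 fun s hs => (ne_of_lt hs : s ≠ 0))).eventually
      (lt_mem_nhds hc)
  have h2 : ∀ᶠ s in 𝓝[<] (0 : ℝ), -(c / ρ) < φ b s :=
    nhdsWithin_le_nhds (((hφ.continuous b).tendsto 0).eventually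
      (lt_mem_nhds (by rw [h0]; linarith)))
  obtain ⟨l, hl, hlS⟩ := (mem_nhdsLT_iff_exists_Ioo_subset).1 (h1.and h2)
  have hl0 : l < 0 := hl
  refine ⟨-l, by linarith, fun t ht => ?_⟩
  obtain ⟨h3, h4⟩ := hlS (show -t ∈ Ioo l 0 from ⟨by linarith [ht.2], by linarith [ht.1]⟩)
  refine ⟨h4, ?_⟩
  rw [slope_def_field, h0, sub_zero] at h3
  have ht0 : -t < 0 := by linarith [ht.1]
  have := (div_pos_iff.1 h3).resolve_left fun h => by linarith [h.2]
  linarith [this.1]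

theorem reachesBarrierActively_smoothFlow (hs : SmoothingScale c ρ b ε)
    (hφε : IsODEFlow (smoothDrift c ρ b ε) φε) : ReachesBarrierActively c ρ b φε := by
  rintro ⟨y, hy, t, -, h⟩
  obtain ⟨κ, hκ⟩ := exists_lipschitzWith_smoothDrift hs
  have := hφε.eq_of_equilibrium hκ (smoothDrift_eq_zero hs le_rfl) h 0
  rw [(hφε y).1] at this
  exact absurd this hy.2.ne

end Flows

/-! ### Comparison of the dividend rates -/

section Dividends

variable {c ρ b ε : ℝ} {φ φε : ℝ → ℝ → ℝ} {h : ℝ → ℝ}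

theorem isDividendRate_dividend (hc : 0 < c) : IsDividendRate c (dividend c) where
  measurable := by
    have : dividend c = fun z => if z.1 = Phase.barrier then c else 0 := by
      ext ⟨k, y⟩
      cases k <;> simp [dividend]
    rw [this]
    exact Measurable.ite (measurableSet_phase_eq _) measurable_const measurable_const
  nonneg := by rintro ⟨k, y⟩; cases k <;> simp [dividend, hc.le]
  le := by rintro ⟨k, y⟩; cases k <;> simp [dividend, hc.le]
  barrier _ := rfl
  ruined _ := rfl
  critical _ := rfl

theorem isDividendRate_smoothDividend (hc : 0 < c) (hh : IsHeaviside 2 h) :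
    IsDividendRate c (smoothDividend c b ε h) where
  measurable := by
    have hm : Measurable h := hh.monotone.measurable
    have : smoothDividend c b ε h = fun z => if z.1 = Phase.active then c * h ((z.2 - b + ε) / ε)
        else if z.1 = Phase.barrier then c else 0 := by
      ext ⟨k, y⟩
      cases k <;> simp [smoothDividend]
    rw [this]
    exact Measurable.ite (measurableSet_phase_eq _) (by fun_prop)
      (Measurable.ite (measurableSet_phase_eq _) measurable_const measurable_const)
  nonneg := by
    rintro ⟨k, y⟩
    cases k <;> simp [smoothDividend, hc.le]
    exact mul_nonneg hc.le (hh.mem_Icc _).1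
  le := by
    rintro ⟨k, y⟩
    cases k <;> simp [smoothDividend, hc.le]
    exact mul_le_of_le_one_right hc.le (hh.mem_Icc _).2
  barrier _ := rfl
  ruined _ := rfl
  critical _ := rfl

theorem surplusReward_dividend (z : ℝ) :
    surplusReward c b (dividend c) z = if z < b then 0 else c := rfl

theorem surplusReward_smoothDividend (z : ℝ) :
    surplusReward c b (smoothDividend c b ε h) z =
      if z < b then c * h ((z - b + ε) / ε) else c := rfl

/-- Below the barrier, the dividends which are not paid are dominated by the speed at which the
smoothed flow approaches the barrier. -/
theorem mul_one_sub_heaviside_le (hs : SmoothingScale c ρ b ε) (hεc : ε ≤ c / ρ / 2)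
    (hh : IsHeaviside 2 h) {L : ℝ≥0} (hL : LipschitzWith L (iteratedDeriv 2 h)) {y : ℝ}
    (h1 : -ε ≤ y) (h2 : y < b) :
    c - c * h ((y - b + ε) / ε) ≤ (2 + L) * smoothDrift c ρ b ε y := by
  obtain ⟨hc, hρ, hε, hεb, hεc'⟩ := id hs
  have hnn := smoothDrift_nonneg hs y
  have hL0 : (0 : ℝ) ≤ L := L.2
  rcases le_total y (b - ε) with h3 | h3
  · have h4 := le_mul_smoothDrift hs hεc h1 h3
    have h5 : 2 * ρ / c * ε ≤ 1 := by
      rw [div_div, le_div_iff₀ (by positivity)] at hεc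
      rw [div_mul_eq_mul_div, div_le_one hc]
      linarith
    have h6 : 0 ≤ c * h ((y - b + ε) / ε) := mul_nonneg hc.le (hh.mem_Icc _).1
    nlinarith
  · have hu0 : 0 ≤ (b - y) / ε := div_nonneg (by linarith) hε.le
    have hu1 : (b - y) / ε ≤ 1 := (div_le_one hε).2 (by linarith)
    have h4 := hh.exists_cubic_bound hL hu0
    have h5 : 1 - (b - y) / ε = (y - b + ε) / ε := by field_simp; ring
    rw [h5] at h4
    rw [smoothDrift_eq_smoothStep hs h3 h2] at hnn ⊢
    have h6 : (L : ℝ) * ((b - y) / ε) ^ 3 ≤ L * smoothStep ((b - y) / ε) :=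
      mul_le_mul_of_nonneg_left (le_smoothStep hu0 hu1) hL0
    have h7 : c * (1 - h ((y - b + ε) / ε)) ≤ c * (L * smoothStep ((b - y) / ε)) :=
      mul_le_mul_of_nonneg_left (h4.trans h6) hc.le
    linarith

theorem lintegral_smoothReward_sub_le (hs : SmoothingScale c ρ b ε) (hh : IsHeaviside 2 h)
    (hφ : IsODEFlow (drift c ρ) φ) (hφε : IsODEFlow (smoothDrift c ρ b ε) φε) (y : ℝ) :
    ∫⁻ t in Ici (0 : ℝ), ENNReal.ofReal (surplusReward c b (smoothDividend c b ε h) (φε y t) -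
      surplusReward c b (dividend c) (φ y t)) ≤ ENNReal.ofReal (2 * ε) := by
  obtain ⟨hc, hρ, hε, hεb, hεc'⟩ := id hs
  have hlip := lipschitzWith_drift hc hρ
  have hmono := hφ.monotone (drift_nonneg hc hρ) y
  set S : Set ℝ := {t | 0 ≤ t ∧ b - 2 * ε ≤ φ y t ∧ φ y t < b} with hS
  have hSm : MeasurableSet S := by
    have hm := (hφ.continuous y).measurable
    exact measurableSet_Ici.inter ((measurableSet_le measurable_const hm).inter
      (measurableSet_lt hm measurable_const))
  have hpt : ∀ t ∈ Ici (0 : ℝ), ENNReal.ofReal (surplusReward c b (smoothDividend c b ε h) (φε y t) -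
      surplusReward c b (dividend c) (φ y t)) ≤ S.indicator (fun _ => ENNReal.ofReal c) t := by
    intro t ht
    have ht0 : 0 ≤ t := ht
    have hle := smoothFlow_le_flow hs hφ hφε y ht0
    have hrc := (isDividendRate_smoothDividend (b := b) (ε := ε) hc hh).surplusReward_le
      (b := b) (φε y t)
    by_cases hb : φ y t < b
    · by_cases hb2 : b - 2 * ε ≤ φ y t
      · rw [indicator_of_mem (show t ∈ S from ⟨ht0, hb2, hb⟩)]
        rw [surplusReward_dividend, if_pos hb, sub_zero]
        exact ENNReal.ofReal_le_ofReal hrc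
      · rw [surplusReward_dividend, if_pos hb, surplusReward_smoothDividend,
          if_pos (hle.trans_lt hb), hh.eq_zero]
        · simp
        · rw [div_lt_iff₀ hε]
          linarith
    · rw [surplusReward_dividend, if_neg hb, ENNReal.ofReal_of_nonpos (by linarith)]
      exact zero_le
  have hvol : volume S ≤ ENNReal.ofReal (2 * ε / c) := by
    have hlt : ∀ s ∈ S, ∀ t ∈ S, s ≤ t → t - s ≤ 2 * ε / c := by
      intro s hs' t ht' hst
      have hlin : ∀ r, HasDerivAt (fun r => c * (r - s)) c r := fun r => by
        simpa using ((hasDerivAt_id r).sub_const s).const_mul c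
      have h1 : c * (t - s) ≤ φ y t - φ y s :=
        le_of_subsolution_of_supersolution (g := fun _ => c) (κ := 0) (a := s) (b := t)
          (u := fun r => c * (r - s)) (z := fun r => φ y r - φ y s) (LipschitzWith.const c) hlin
          (fun r => ((hφ y).2 r).sub_const _) (fun _ _ => le_rfl)
          (fun r hr => by
            have h2 : 0 ≤ φ y r := by
              have := hmono hr.1
              linarith [hs'.2.1]
            rw [drift_eq_max_min hc hρ, min_eq_left (by nlinarith), max_eq_right hc.le])
          (by simp) ⟨hst, le_rfl⟩
      rw [le_div_iff₀ hc]
      linarith [ht'.2.2, hs'.2.1]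
    refine (Real.volume_le_diam S).trans (Metric.ediam_le fun s hs' t ht' => ?_)
    rw [edist_dist, Real.dist_eq]
    refine ENNReal.ofReal_le_ofReal (abs_sub_le_iff.2 ⟨?_, ?_⟩)
    · rcases le_total t s with h1 | h1
      · exact hlt t ht' s hs' h1
      · exact (by linarith : s - t ≤ 0).trans (by positivity)
    · rcases le_total s t with h1 | h1
      · exact hlt s hs' t ht' h1
      · exact (by linarith : t - s ≤ 0).trans (by positivity)
  calc _ ≤ ∫⁻ t in Ici (0 : ℝ), S.indicator (fun _ => ENNReal.ofReal c) t :=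
        setLIntegral_mono' measurableSet_Ici hpt
    _ ≤ ∫⁻ t, S.indicator (fun _ => ENNReal.ofReal c) t := setLIntegral_le_lintegral _ _
    _ = ENNReal.ofReal c * volume S := lintegral_indicator_const hSm _
    _ ≤ ENNReal.ofReal c * ENNReal.ofReal (2 * ε / c) := by gcongr
    _ = ENNReal.ofReal (2 * ε) := by
        rw [← ENNReal.ofReal_mul hc.le]
        congr 1
        field_simp

theorem lintegral_reward_sub_le (hs : SmoothingScale c ρ b ε) (hεc : ε ≤ c / ρ / 2)
    (hεD : (1 + 4 * ρ * b / c) * ε ≤ b)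
    (hh : IsHeaviside 2 h) {L : ℝ≥0} (hL : LipschitzWith L (iteratedDeriv 2 h))
    (hφ : IsODEFlow (drift c ρ) φ) (hφε : IsODEFlow (smoothDrift c ρ b ε) φε) (y : ℝ) :
    ∫⁻ t in Ici (0 : ℝ), ENNReal.ofReal (surplusReward c b (dividend c) (φ y t) -
      surplusReward c b (smoothDividend c b ε h) (φε y t)) ≤
      ENNReal.ofReal ((2 + L) * ((1 + 4 * ρ * b / c) * ε)) := by
  obtain ⟨hc, hρ, hε, hεb, hεc'⟩ := id hs
  have hL0 : (0 : ℝ) ≤ L := L.2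
  have hup := hφ.isUpwardFlow (lipschitzWith_drift hc hρ) (drift_nonneg hc hρ)
  have hmonoε := hφε.monotone (smoothDrift_nonneg hs) y
  rcases le_or_gt b y with hy | hy
  · have hz : ∀ t ∈ Ici (0 : ℝ), ENNReal.ofReal (surplusReward c b (dividend c) (φ y t) -
        surplusReward c b (smoothDividend c b ε h) (φε y t)) = 0 := by
      intro t ht
      have h1 : y ≤ φε y t := by
        have := hmonoε ht
        rwa [(hφε y).1] at this
      rw [surplusReward_smoothDividend, if_neg (by linarith), ENNReal.ofReal_of_nonpos]
      linarith [(isDividendRate_dividend hc).surplusReward_le (b := b) (φ y t)]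
    rw [setLIntegral_congr_fun measurableSet_Ici hz]
    simp
  have hbelow : ∀ t, 0 ≤ t → φ y t < b → ENNReal.ofReal (surplusReward c b (dividend c) (φ y t) -
      surplusReward c b (smoothDividend c b ε h) (φε y t)) = 0 := by
    intro t ht0 hb
    rw [surplusReward_dividend, if_pos hb, ENNReal.ofReal_of_nonpos]
    rw [surplusReward_smoothDividend, if_pos ((smoothFlow_le_flow hs hφ hφε y ht0).trans_lt hb)]
    linarith [mul_nonneg hc.le (hh.mem_Icc ((φε y t - b + ε) / ε)).1]
  by_cases hhit : hitTime b φ y = ⊤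
  · rw [setLIntegral_congr_fun measurableSet_Ici fun t ht => hbelow t ht
      ((hup.lt_hitTime_iff ht).1 (by rw [hhit]; exact ENNReal.ofReal_lt_top))]
    simp
  set T := (hitTime b φ y).toReal with hT
  have hT0 : 0 ≤ T := ENNReal.toReal_nonneg
  have hpt : ∀ t ∈ Ici (0 : ℝ), ENNReal.ofReal (surplusReward c b (dividend c) (φ y t) -
      surplusReward c b (smoothDividend c b ε h) (φε y t)) ≤
      (Ici T).indicator (fun t => ENNReal.ofReal ((2 + L) * smoothDrift c ρ b ε (φε y t))) t := by
    intro t ht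
    have ht0 : 0 ≤ t := ht
    by_cases hb : φ y t < b
    · rw [hbelow t ht0 hb]
      exact zero_le
    · have hbt := not_lt.1 hb
      have hTt : T ≤ t := ENNReal.toReal_le_of_le_ofReal ht0 ((hup.hitTime_le_iff ht0).2 hbt)
      rw [indicator_of_mem (mem_Ici.2 hTt)]
      refine ENNReal.ofReal_le_ofReal ?_
      have h1 := sub_smoothFlow_le hs hεc hφ hφε (y := y) ht0
      rw [min_eq_right hbt] at h1
      rw [surplusReward_dividend, if_neg hb, surplusReward_smoothDividend]
      split_ifs with h2
      · exact mul_one_sub_heaviside_le hs hεc hh hL (by linarith) h2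
      · rw [sub_self]
        exact mul_nonneg (by positivity) (smoothDrift_nonneg hs _)
  refine (setLIntegral_mono' measurableSet_Ici hpt).trans ?_
  have hφT : φ y T = b := hup.apply_hitTime hy hhit
  have h1 := sub_smoothFlow_le hs hεc hφ hφε (y := y) hT0
  rw [hφT, min_self] at h1
  have h2 := lintegral_deriv_le_of_bounded (u := φε y) (B := b) (hφε y).2
    (fun t => smoothDrift_nonneg hs _) (fun t => (hmonoε (le_max_left t 0)).trans
      (smoothFlow_le_barrier hs hφε hy.le (le_max_right t 0))) T
  calc _ ≤ ∫⁻ t, (Ici T).indicator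
        (fun t => ENNReal.ofReal ((2 + L) * smoothDrift c ρ b ε (φε y t))) t :=
        setLIntegral_le_lintegral _ _
    _ = ∫⁻ t in Ioi T, ENNReal.ofReal (2 + L) * ENNReal.ofReal (smoothDrift c ρ b ε (φε y t)) := by
        rw [lintegral_indicator measurableSet_Ici, setLIntegral_congr Ioi_ae_eq_Ici.symm]
        simp_rw [ENNReal.ofReal_mul (by positivity : (0 : ℝ) ≤ 2 + L)]
    _ ≤ ENNReal.ofReal (2 + L) * ENNReal.ofReal ((1 + 4 * ρ * b / c) * ε) := by
        rw [lintegral_const_mul' _ _ ENNReal.ofReal_ne_top]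
        gcongr
        exact h2.trans (ENNReal.ofReal_le_ofReal h1)
    _ = _ := by rw [← ENNReal.ofReal_mul (by positivity)]

end Dividends

theorem abs_toReal_sub_toReal_le {a a' : ℝ≥0∞} (ha : a ≠ ⊤) (ha' : a' ≠ ⊤) {e : ℝ} (he : 0 ≤ e)
    (h : a ≤ a' + ENNReal.ofReal e) (h' : a' ≤ a + ENNReal.ofReal e) :
    |a.toReal - a'.toReal| ≤ e := by
  have key : ∀ {x y : ℝ≥0∞}, y ≠ ⊤ → x ≤ y + ENNReal.ofReal e → x.toReal - y.toReal ≤ e := by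
    intro x y hy hxy
    have := ENNReal.toReal_mono (ENNReal.add_ne_top.2 ⟨hy, ENNReal.ofReal_ne_top⟩) hxy
    rw [ENNReal.toReal_add hy ENNReal.ofReal_ne_top, ENNReal.toReal_ofReal he] at this
    linarith
  exact abs_sub_le_iff.2 ⟨key ha' h, key ha h'⟩

/-- Near `ε = 0`, the value functions of the smoothed and of the original model differ by `O(ε)`. -/
theorem exists_bound_valueFunction_sub {c ρ b lam δ : ℝ} (hc : 0 < c) (hρ : 0 < ρ) (hb : 0 < b)
    (hlam : 0 < lam) (hδ : 0 < δ) {f : ℝ → ℝ} (hf : IsClaimDensity f) {h : ℝ → ℝ}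
    (hh : IsHeaviside 2 h) {L : ℝ≥0} (hL : LipschitzWith L (iteratedDeriv 2 h)) :
    ∃ C : ℝ, 0 ≤ C ∧ ∀ ε : ℝ, SmoothingScale c ρ b ε → ε ≤ c / ρ / 2 →
      (1 + 4 * ρ * b / c) * ε ≤ b → ∀ φ φε : ℝ → ℝ → ℝ, IsODEFlow (drift c ρ) φ →
      IsODEFlow (smoothDrift c ρ b ε) φε → ∀ y,
      |(valueFunction c ρ b lam δ f φε (surplusReward c b (smoothDividend c b ε h)) y).toReal -
        (valueFunction c ρ b lam δ f φ (surplusReward c b (dividend c)) y).toReal| ≤ C * ε := by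
  obtain ⟨B, hB0, hB⟩ := hf.exists_bound
  obtain ⟨M, hM0, hM⟩ := hf.exists_lipschitz
  have hcρ : 0 < c / ρ := div_pos hc hρ
  have hL0 : (0 : ℝ) ≤ L := L.2
  set D : ℝ := 1 + 4 * ρ * b / c with hD
  have hD0 : 0 < D := by positivity
  set κ : ℝ := c / δ * (M * (b - -(c / ρ)) + B) with hκ
  have hκ0 : 0 ≤ κ := by
    have : 0 ≤ b - -(c / ρ) := by linarith
    positivity
  set A : ℝ := (2 + (2 + L) * D) + lam * (κ * D) / (lam + δ) with hA
  have hA0 : 0 ≤ A := by positivity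
  refine ⟨A * (lam + δ) / δ, by positivity, fun ε hs hεc hεD φ φε hφ hφε y => ?_⟩
  obtain ⟨κε, hκε⟩ := exists_lipschitzWith_smoothDrift hs
  have hε := hs.pos
  have hup := hφ.isUpwardFlow (lipschitzWith_drift hc hρ) (drift_nonneg hc hρ)
  have hupε := hφε.isUpwardFlow hκε (smoothDrift_nonneg hs)
  have hd := isDividendRate_dividend hc
  have hdε := isDividendRate_smoothDividend (b := b) (ε := ε) hc hh
  have hlip : ∀ u : ℝ → ℝ≥0∞, Measurable u → (∀ y, u y ≤ ENNReal.ofReal (c / δ)) →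
      (∀ y, y ≤ -(c / ρ) → u y = 0) → ∀ z z', z ≤ b → z' ≤ b →
      afterClaim f u z ≤ afterClaim f u z' + ENNReal.ofReal (κ * |z - z'|) :=
    fun u hu hu1 hu2 z z' hz _ => afterClaim_le_add hf hB0 hM0 hB hM hu (by positivity) hu1 hu2
      (by linarith) hz
  have hdist := fun (y t : ℝ) (ht : 0 ≤ t) => abs_min_sub_min_le hs hεc hφ hφε y ht
  have hAε : (2 + (2 + L) * D) * ε + lam * (κ * (D * ε)) / (lam + δ) = A * ε := by
    rw [hA]; ring
  have he1 : 2 * ε ≤ (2 + (2 + L) * D) * ε := by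
    have : 0 ≤ (2 + (L : ℝ)) * D * ε := by positivity
    linarith
  have he2 : (2 + (L : ℝ)) * (D * ε) ≤ (2 + (2 + L) * D) * ε := by linarith
  have hval : A * (lam + δ) / δ * ε = A * ε * (lam + δ) / δ := by ring
  rw [hval]
  refine abs_toReal_sub_toReal_le
    (ne_top_of_le_ne_top ENNReal.ofReal_ne_top
      (valueFunction_le hc hlam hδ hf hdε.surplusReward_le y))
    (ne_top_of_le_ne_top ENNReal.ofReal_ne_top
      (valueFunction_le hc hlam hδ hf hd.surplusReward_le y)) (by positivity) ?_ ?_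
  · refine valueFunction_le_add hc hlam hδ hf hupε hup hdε.measurable_surplusReward
      hd.measurable_surplusReward hd.surplusReward_le (by positivity)
      (fun u hu hu1 hu2 y => ?_) y
    rw [← hAε]
    exact valueStep_le_valueStep_add hlam hδ hf hupε hup hdε.measurable_surplusReward
      hd.measurable_surplusReward hu hκ0 (by positivity) (by positivity) (hlip u hu hu1 hu2)
      (hdist y) ((lintegral_smoothReward_sub_le hs hh hφ hφε y).trans
        (ENNReal.ofReal_le_ofReal he1))
  · refine valueFunction_le_add hc hlam hδ hf hup hupε hd.measurable_surplusReward
      hdε.measurable_surplusReward hdε.surplusReward_le (by positivity)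
      (fun u hu hu1 hu2 y => ?_) y
    rw [← hAε]
    exact valueStep_le_valueStep_add hlam hδ hf hup hupε hd.measurable_surplusReward
      hdε.measurable_surplusReward hu hκ0 (by positivity) (by positivity) (hlip u hu hu1 hu2)
      (fun t ht => by rw [abs_sub_comm]; exact hdist y t ht)
      ((lintegral_reward_sub_le hs hεc hεD hh hL hφ hφε y).trans
        (ENNReal.ofReal_le_ofReal he2))

theorem mainTheorem2 (c ρ b lam δ : ℝ) (hc : 0 < c) (hρ : 0 < ρ) (hb : 0 < b) (hlam : 0 < lam)
    (hδ : 0 < δ) (f : ℝ → ℝ) (hf : IsClaimDensity f)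
    (h : ℝ → ℝ) (hh : IsHeaviside 2 h) (hLip : ∃ L : ℝ≥0, LipschitzWith L (iteratedDeriv 2 h)) :
    ∃ C : ℝ, 0 < C ∧ ∀ ε : ℝ, 0 < ε → ε ≤ b / 2 → ε ≤ c / ρ →
      ∀ φ φε : ℝ → ℝ → ℝ, IsODEFlow (drift c ρ) φ → IsODEFlow (smoothDrift c ρ b ε) φε →
      ∀ x : Phase × ℝ, x ∈ (loanModel c ρ b lam f φ).stateSpace →
      ∀ (Ω : Type*) [MeasurableSpace Ω] (P : Measure Ω) [IsProbabilityMeasure P]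
        (X : ℝ → Ω → Phase × ℝ), (loanModel c ρ b lam f φ).IsPDMP P x X →
      ∀ (Ω' : Type*) [MeasurableSpace Ω'] (P' : Measure Ω') [IsProbabilityMeasure P']
        (X' : ℝ → Ω' → Phase × ℝ), (loanModel c ρ b lam f φε).IsPDMP P' x X' →
      |expectedReward P' X' δ (smoothDividend c b ε h) (cemetery c ρ b)
        - expectedReward P X δ (dividend c) (cemetery c ρ b)| ≤ C * ε := by
  obtain ⟨L, hL⟩ := hLip
  obtain ⟨C, hC0, hC⟩ := exists_bound_valueFunction_sub hc hρ hb hlam hδ hf hh hL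
  have hD0 : 0 < 1 + 4 * ρ * b / c := by positivity
  set ε₀ : ℝ := min (c / ρ / 2) (b / (1 + 4 * ρ * b / c)) with hε₀
  have hε₀0 : 0 < ε₀ := lt_min (by positivity) (by positivity)
  refine ⟨C + c / δ / ε₀, by positivity, ?_⟩
  intro ε hε hεb hεc φ φε hφ hφε x hx Ω _ P _ X hX Ω' _ P' _ X' hX'
  have hs : SmoothingScale c ρ b ε := ⟨hc, hρ, hε, hεb, hεc⟩
  obtain ⟨κε, hκε⟩ := exists_lipschitzWith_smoothDrift hs
  have hup := hφ.isUpwardFlow (lipschitzWith_drift hc hρ) (drift_nonneg hc hρ)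
  have hupε := hφε.isUpwardFlow hκε (smoothDrift_nonneg hs)
  have hd := isDividendRate_dividend hc
  have hdε := isDividendRate_smoothDividend (b := b) (ε := ε) hc hh
  rw [expectedReward_eq_valueFunction hc hρ hb hlam hδ hf hup
      (reachesBarrierActively_flow hc hρ hb hφ) hd hx hX,
    expectedReward_eq_valueFunction hc hρ hb hlam hδ hf hupε
      (reachesBarrierActively_smoothFlow hs hφε) hdε hx hX']
  by_cases hsmall : ε ≤ ε₀
  · have h1 : (1 + 4 * ρ * b / c) * ε ≤ b :=
      (le_div_iff₀' hD0).1 (hsmall.trans (min_le_right _ _))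
    refine (hC ε hs (hsmall.trans (min_le_left _ _)) h1 φ φε hφ hφε x.2).trans ?_
    have : 0 ≤ c / δ / ε₀ * ε := by positivity
    linarith
  · have hcδ : 0 ≤ c / δ := by positivity
    have hbound : ∀ {ψ : ℝ → ℝ → ℝ} {r : ℝ → ℝ}, (∀ y, r y ≤ c) →
        (valueFunction c ρ b lam δ f ψ r x.2).toReal ≤ c / δ := fun hr =>
      ENNReal.toReal_le_of_le_ofReal hcδ (valueFunction_le hc hlam hδ hf hr x.2)
    have h1 := hbound (ψ := φ) (hd.surplusReward_le (b := b))
    have h2 := hbound (ψ := φε) (hdε.surplusReward_le (b := b))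
    have h3 : c / δ ≤ c / δ / ε₀ * ε := by
      rw [div_mul_eq_mul_div, le_div_iff₀ hε₀0]
      exact mul_le_mul_of_nonneg_left (not_le.1 hsmall).le hcδ
    have h4 : 0 ≤ C * ε := by positivity
    rw [add_mul]
    refine abs_sub_le_iff.2 ⟨?_, ?_⟩
    · linarith [(valueFunction c ρ b lam δ f φ (surplusReward c b (dividend c)) x.2).toReal_nonneg]
    · linarith [(valueFunction c ρ b lam δ f φε
        (surplusReward c b (smoothDividend c b ε h)) x.2).toReal_nonneg]
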